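/- \textbf{Setting.} Let $\lambda,\mu\in L^\infty(\mathbb R^3)$ be real with $\mu\ge c$ and $3\lambda+2\mu\ge c$ almost everywhere for some $c>0$ (density $1$), and let $Lu=\nabla(\lambda\,\mathrm{div}\,u)+\nabla\cdot(2\mu\widehat\nabla u)$, where $\widehat\nabla u=\frac12(\nabla u+(\nabla u)^T)$. Let $E$ be the Hilbert space completion of $H^1(\mathbb R^3;\mathbb C^3)\oplus L^2(\mathbb R^3;\mathbb C^3)$ in the energy inner product $$\langle (f_0,f_1),(g_0,g_1)\rangle=\int_{\mathbb R^3}\big(f_1\cdot\bar g_1+\lambda\,\mathrm{div} f_0\,\mathrm{div}\,\bar g_0+2\mu\,\widehat\nabla f_0:\widehat\nabla\bar g_0\big)\,dx .$$ Let $R_t:E\to E$ be the (continuous extension of the) map that takes Cauchy data $(u,\partial_tu)|_{t=0}$ to $(u,\partial_tu)$ at time $t$, where $u\in C(\mathbb R;H^1)\cap C^1(\mathbb R;L^2)$ is the weak solution of $\partial_t^2u=Lu$ on $\mathbb R\times\mathbb R^3$. Let $\nu(f_0,f_1)=(f_0,-f_1)$, let $T>0$, and let $R=\nu R_{2T}$.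 Let $\Theta,\Upsilon\subset\mathbb R^3$ be open with $\overline\Theta\subset\Upsilon$ and put $\Theta^\star=\Upsilon\setminus\overline\Theta$. Let $\mathbf H$, $\tilde{\mathbf H}^\star$, $\tilde{\mathbf C}$ be the closed subspaces $H^1_0(U)\oplus L^2(U)$ of $E$ (closures in $E$; the closure adds nothing when $U$ is bounded) for $U=\Theta,\Theta^\star,\Upsilon$ respectively. Let $\mathbf G=\{g\in\tilde{\mathbf H}^\star: R_{2T}g\in\tilde{\mathbf H}^\star\}$ be the space of data whose wave fields vanish on $\Theta$ (and are supported in $\overline\Upsilon$) at times $0$ and $2T$, and let $\mathbf C$ and $\mathbf H^\star$ be the orthogonal complements of $\mathbf G$ in $\tilde{\mathbf C}$ and in $\tilde{\mathbf H}^\star$. Let $\pi^\star$ be the orthogonal projection of $E$ onto $\tilde{\mathbf H}^\star$; its restriction to $\mathbf C$ is the orthogonal projection of $\mathbf C$ onto $\mathbf H^\star$. Let $\bar\pi=I-\pi^\star$, and let $\mathrm{Im}(R_T\pi^\star)$, $\mathrm{Im}(\nu R_T\pi^\star)$, $\mathrm{Im}(R_{-T}\pi^\star)$ denote images of $\mathbf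 C$. Let $\mathcal C=\overline{\mathrm{Im}(R_T\pi^\star)+\mathrm{Im}(\nu R_T\pi^\star)}$, and let $\Pi_{\mathcal C^\perp}$ be the orthogonal projection of $E$ onto $\mathcal C^\perp$. \textbf{Lemma.} Let $h_0\in\mathbf H$ and $h_\infty\in\mathbf C$. (i) If $(I-\pi^\star R\pi^\star R)h_\infty=h_0$, then $R_{-T}\bar\pi R_{2T}h_\infty$ is orthogonal to $\mathrm{Im}(R_T\pi^\star)+\mathrm{Im}(\nu R_T\pi^\star)$ and to $\mathrm{Im}(R_T\pi^\star)+\mathrm{Im}(R_{-T}\pi^\star)$, and $$R_{-T}\bar\pi R_{2T}h_\infty=\Pi_{\mathcal C^\perp}R_Th_0 .$$ (ii) Conversely, if $h_\infty=h_0+k$ with $k\in\mathbf H^\star$ and $R_{-T}\bar\pi R_{2T}h_\infty=\Pi_{\mathcal C^\perp}R_Th_0$, then $(I-\pi^\star R\pi^\star R)h_\infty=h_0$. -/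

import Mathlib

open MeasureTheory UniformSpace
open scoped ContDiff

noncomputable section

namespace ElasticScattering

/-! ### Function spaces on three-dimensional Euclidean space -/

/-- Physical space `ℝ³`. -/
abbrev R3 := EuclideanSpace ℝ (Fin 3)

/-- The values `ℂ³` of displacement fields. -/
abbrev C3 := EuclideanSpace ℂ (Fin 3)

/-- `L²(ℝ³; ℂ³)`. -/
abbrev L2 := Lp C3 2 (volume : Measure R3)

/-- Scalar test functions `C_c^∞(ℝ³)`. -/
def IsTest (φ : R3 → ℝ) : Prop := ContDiff ℝ ∞ φ ∧ HasCompactSupport φ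

/-- The classical partial derivative `∂ⱼ φ`. -/
def partialDeriv (j : Fin 3) (φ : R3 → ℝ) (x : R3) : ℝ :=
  fderiv ℝ φ x (EuclideanSpace.single j 1)

/-- `g` is the weak partial derivative `∂ⱼ f`. -/
def IsWeakPartial (j : Fin 3) (f g : L2) : Prop :=
  ∀ φ : R3 → ℝ, IsTest φ → ∫ x, partialDeriv j φ x • f x = - ∫ x, φ x • g x

theorem integrable_smul_L2 {φ : R3 → ℝ} (hφ : Continuous φ) (hc : HasCompactSupport φ)
    (f : L2) : Integrable (fun x => φ x • f x) volume := by
  have h1 : MemLp φ 2 volume := hφ.memLp_of_hasCompactSupport hc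
  have h2 : MemLp f 2 volume := Lp.memLp f
  have := h2.smul (r := 1) h1
  exact memLp_one_iff_integrable.1 this

theorem IsTest.integrable_smul {φ : R3 → ℝ} (hφ : IsTest φ) (f : L2) :
    Integrable (fun x => φ x • f x) volume :=
  integrable_smul_L2 hφ.1.continuous hφ.2 f

theorem IsTest.integrable_partialDeriv_smul {φ : R3 → ℝ} (hφ : IsTest φ) (j : Fin 3) (f : L2) :
    Integrable (fun x => partialDeriv j φ x • f x) volume := by
  refine integrable_smul_L2 ?_ ?_ f
  · exact (hφ.1.continuous_fderiv (by simp)).clm_apply continuous_const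
  · exact hφ.2.fderiv_apply (𝕜 := ℝ) _

/-- The Sobolev space `H¹(ℝ³; ℂ³)`: pairs `(f, (g₁, g₂, g₃))` of `L²` fields with `gⱼ = ∂ⱼ f`
weakly. The `g`s are determined by `f`, and the topology is that of the `H¹` norm. -/
def H1 : Submodule ℂ (L2 × (Fin 3 → L2)) where
  carrier := {p | ∀ j, IsWeakPartial j p.1 (p.2 j)}
  zero_mem' := by
    intro j φ _
    have h0 : ∀ ψ : R3 → ℝ, ∫ x, ψ x • (0 : L2) x = 0 := by
      intro ψ
      rw [← integral_zero R3 C3 (μ := volume)]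
      refine integral_congr_ae ?_
      filter_upwards [Lp.coeFn_zero C3 2 (volume : Measure R3)] with x hx
      rw [hx, Pi.zero_apply, smul_zero]
    exact (h0 (partialDeriv j φ)).trans (by rw [← neg_zero]; exact congrArg _ (h0 φ).symm)
  add_mem' := by
    intro p q hp hq j φ hφ
    have key : ∀ ψ : R3 → ℝ, ∀ f g : L2, Integrable (fun x => ψ x • f x) volume →
        Integrable (fun x => ψ x • g x) volume →
        ∫ x, ψ x • (f + g : L2) x = (∫ x, ψ x • f x) + ∫ x, ψ x • g x := by
      intro ψ f g hf hg
      rw [← integral_add hf hg]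
      refine integral_congr_ae ?_
      filter_upwards [Lp.coeFn_add f g] with x hx
      rw [hx, Pi.add_apply, smul_add]
    have e1 := key _ p.1 q.1 (hφ.integrable_partialDeriv_smul j _)
      (hφ.integrable_partialDeriv_smul j _)
    have e2 := key φ (p.2 j) (q.2 j) (hφ.integrable_smul _) (hφ.integrable_smul _)
    have e3 := hp j φ hφ
    have e4 := hq j φ hφ
    simp only [Prod.fst_add, Prod.snd_add, Pi.add_apply]
    rw [e1, e2, e3, e4, neg_add]
  smul_mem' := by
    intro c p hp j φ hφ
    have key : ∀ ψ : R3 → ℝ, ∀ f : L2,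
        ∫ x, ψ x • (c • f : L2) x = c • ∫ x, ψ x • f x := by
      intro ψ f
      rw [← integral_smul]
      refine integral_congr_ae ?_
      filter_upwards [Lp.coeFn_smul c f] with x hx
      rw [hx, Pi.smul_apply, smul_comm]
    have e3 := hp j φ hφ
    simp only [Prod.smul_fst, Prod.smul_snd, Pi.smul_apply]
    rw [key, key, e3, smul_neg]

/-- `H¹₀(U; ℂ³)`, extended by zero: the closure of `C_c^∞(U; ℂ³)` in `H¹(ℝ³; ℂ³)`. -/
def H10 (U : Set R3) : Submodule ℂ H1 :=
  (Submodule.span ℂ {f : H1 | ∃ φ : R3 → C3, ContDiff ℝ ∞ φ ∧ HasCompactSupport φ ∧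
    tsupport φ ⊆ U ∧ f.1.1 =ᵐ[volume] φ}).topologicalClosure

/-- `L²(U; ℂ³)`, extended by zero. -/
def L2on (U : Set R3) : Submodule ℂ L2 where
  carrier := {f | ∀ᵐ x ∂(volume : Measure R3), x ∉ U → f x = 0}
  zero_mem' := by
    change ∀ᵐ x ∂(volume : Measure R3), x ∉ U → (0 : L2) x = 0
    filter_upwards [Lp.coeFn_zero C3 2 (volume : Measure R3)] with x hx _
    rw [hx, Pi.zero_apply]
  add_mem' := by
    intro f g hf hg
    change ∀ᵐ x ∂(volume : Measure R3), x ∉ U → (f + g : L2) x = 0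
    filter_upwards [Lp.coeFn_add f g, hf, hg] with x hx h1 h2 hU
    rw [hx, Pi.add_apply, h1 hU, h2 hU, add_zero]
  smul_mem' := by
    intro c f hf
    change ∀ᵐ x ∂(volume : Measure R3), x ∉ U → (c • f : L2) x = 0
    filter_upwards [Lp.coeFn_smul c f, hf] with x hx h1 hU
    rw [hx, Pi.smul_apply, h1 hU, smul_zero]

/-- The divergence of an `H¹` field. -/
def divergence (f : H1) (x : R3) : ℂ := ∑ j, f.1.2 j x j

/-- The entry `(i, j)` of the symmetric gradient `(∇f + (∇f)ᵀ) / 2` of an `H¹` field. -/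
def strain (f : H1) (i j : Fin 3) (x : R3) : ℂ := (f.1.2 i x j + f.1.2 j x i) / 2

/-! ### The elastic medium and the energy space -/

/-- Lamé parameters of an isotropic elastic medium of density one in `ℝ³`: bounded measurable
functions satisfying the strong convexity condition uniformly. -/
structure Medium where
  lam : R3 → ℝ
  mu : R3 → ℝ
  measurable_lam : Measurable lam
  measurable_mu : Measurable mu
  bounded : ∃ C : ℝ, ∀ᵐ x ∂(volume : Measure R3), |lam x| ≤ C ∧ |mu x| ≤ C
  strongly_convex : ∃ c : ℝ, 0 < c ∧
    ∀ᵐ x ∂(volume : Measure R3), c ≤ mu x ∧ c ≤ 3 * lam x + 2 * mu x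

/-- The integrand of the elastic form (conjugate linear in the first argument). -/
def elasticDensity (M : Medium) (f g : H1) (x : R3) : ℂ :=
  (M.lam x : ℂ) * (star (divergence f x) * divergence g x) +
    2 * (M.mu x : ℂ) * ∑ i, ∑ j, star (strain f i j x) * strain g i j x

/-- The sesquilinear form of `-L`, where `L u = ∇(λ div u) + ∇ · (2 μ ∇̂u)`:
`∫ (λ conj(div f) div g + 2 μ conj(∇̂f) : ∇̂g) dx`. -/
def elasticForm (M : Medium) (f g : H1) : ℂ := ∫ x, elasticDensity M f g x

theorem memLp_coord (f : L2) (i : Fin 3) : MemLp (fun x => f x i) 2 volume :=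
  (EuclideanSpace.proj (𝕜 := ℂ) i : C3 →L[ℂ] ℂ).comp_memLp' (Lp.memLp f)

theorem memLp_divergence (f : H1) : MemLp (divergence f) 2 volume :=
  memLp_finsetSum _ fun j _ => memLp_coord (f.1.2 j) j

theorem memLp_strain (f : H1) (i j : Fin 3) : MemLp (strain f i j) 2 volume := by
  have := ((memLp_coord (f.1.2 i) j).add (memLp_coord (f.1.2 j) i)).const_mul (1 / 2 : ℂ)
  refine this.congr_norm ?_ ?_
  · exact (this.aestronglyMeasurable).congr (by
      filter_upwards with x
      simp [strain]; ring)
  · filter_upwards with x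
    simp [strain]; ring

theorem integrable_coef_mul {m : R3 → ℝ} (hm : Measurable m) {C : ℝ}
    (hC : ∀ᵐ x ∂(volume : Measure R3), |m x| ≤ C) {u v : R3 → ℂ}
    (hu : MemLp u 2 volume) (hv : MemLp v 2 volume) :
    Integrable (fun x => (m x : ℂ) * (star (u x) * v x)) volume := by
  have h1 : Integrable (fun x => star (u x) * v x) volume := by
    have := hu.star.integrable_mul hv
    exact this
  refine h1.bdd_mul (c := C) ?_ ?_
  · exact (Complex.measurable_ofReal.comp hm).aestronglyMeasurable
  · filter_upwards [hC] with x hx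
    simpa using hx

theorem integrable_elasticDensity (M : Medium) (f g : H1) :
    Integrable (elasticDensity M f g) volume := by
  obtain ⟨C, hC⟩ := M.bounded
  have h1 := integrable_coef_mul M.measurable_lam (hC.mono fun _ h => h.1)
    (memLp_divergence f) (memLp_divergence g)
  have h2 : ∀ i j, Integrable (fun x => (M.mu x : ℂ) *
      (star (strain f i j x) * strain g i j x)) volume := fun i j =>
    integrable_coef_mul M.measurable_mu (hC.mono fun _ h => h.2)
      (memLp_strain f i j) (memLp_strain g i j)
  have h3 := (integrable_finsetSum Finset.univ fun i _ =>
    integrable_finsetSum Finset.univ fun j _ => h2 i j).const_mul 2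
  refine (h1.add h3).congr ?_
  filter_upwards with x
  simp [elasticDensity, Finset.mul_sum, mul_assoc]

theorem elasticForm_conj (M : Medium) (f g : H1) :
    star (elasticForm M g f) = elasticForm M f g := by
  have h : ∀ x, elasticDensity M f g x = star (elasticDensity M g f x) := by
    intro x
    simp [elasticDensity, mul_comm]
  simp only [elasticForm, h]
  exact (integral_conj (μ := volume) (f := elasticDensity M g f)).symm

theorem elasticDensity_re_nonneg (l m : ℝ) (hm : 0 ≤ m) (hlm : 0 ≤ 3 * l + 2 * m)
    (e : Fin 3 → Fin 3 → ℂ) :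
    0 ≤ ((l : ℂ) * (star (∑ j, e j j) * ∑ j, e j j) +
      2 * (m : ℂ) * ∑ i, ∑ j, star (e i j) * e i j).re := by
  simp only [Fin.sum_univ_three, Complex.star_def, Complex.add_re, Complex.mul_re,
    Complex.conj_re, Complex.conj_im, Complex.add_im, Complex.mul_im, Complex.ofReal_re,
    Complex.ofReal_im, Complex.re_ofNat, Complex.im_ofNat, map_add]
  set a : Fin 3 → Fin 3 → ℝ := fun i j => (e i j).re with ha
  set b : Fin 3 → Fin 3 → ℝ := fun i j => (e i j).im with hb
  have hoff : 0 ≤ 2 * m * ((a 0 1) ^ 2 + (b 0 1) ^ 2 + (a 0 2) ^ 2 + (b 0 2) ^ 2 + (a 1 0) ^ 2 +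
      (b 1 0) ^ 2 + (a 1 2) ^ 2 + (b 1 2) ^ 2 + (a 2 0) ^ 2 + (b 2 0) ^ 2 + (a 2 1) ^ 2 +
      (b 2 1) ^ 2) := by positivity
  have htr : 0 ≤ (3 * l + 2 * m) * ((a 0 0 + a 1 1 + a 2 2) ^ 2 + (b 0 0 + b 1 1 + b 2 2) ^ 2) := by
    positivity
  have hdev : 0 ≤ 2 * m * ((a 0 0 - a 1 1) ^ 2 + (a 0 0 - a 2 2) ^ 2 + (a 1 1 - a 2 2) ^ 2 +
      (b 0 0 - b 1 1) ^ 2 + (b 0 0 - b 2 2) ^ 2 + (b 1 1 - b 2 2) ^ 2) := by positivity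
  simp only [ha, hb] at hoff htr hdev
  nlinarith [hoff, htr, hdev]

theorem elasticForm_re_nonneg (M : Medium) (f : H1) : 0 ≤ (elasticForm M f f).re := by
  obtain ⟨c, hc, hM⟩ := M.strongly_convex
  have h := integral_re (𝕜 := ℂ) (integrable_elasticDensity M f f)
  have h' : (elasticForm M f f).re = ∫ x, (elasticDensity M f f x).re := h.symm
  rw [h']
  refine integral_nonneg_of_ae ?_
  filter_upwards [hM] with x hx
  have hd : divergence f x = ∑ j, strain f j j x := by
    simp [divergence, strain]
  have := elasticDensity_re_nonneg (M.lam x) (M.mu x) (by linarith) (by linarith)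
    (fun i j => strain f i j x)
  simpa only [elasticDensity, hd, Pi.zero_apply] using this

theorem coeFn_grad_add (f g : H1) (j : Fin 3) :
    ∀ᵐ x ∂(volume : Measure R3), (f + g).1.2 j x = f.1.2 j x + g.1.2 j x := by
  filter_upwards [Lp.coeFn_add (f.1.2 j) (g.1.2 j)] with x hx
  exact hx

theorem coeFn_grad_smul (c : ℂ) (f : H1) (j : Fin 3) :
    ∀ᵐ x ∂(volume : Measure R3), (c • f).1.2 j x = c • f.1.2 j x := by
  filter_upwards [Lp.coeFn_smul c (f.1.2 j)] with x hx
  exact hx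

theorem elasticForm_add_left (M : Medium) (f g h : H1) :
    elasticForm M (f + g) h = elasticForm M f h + elasticForm M g h := by
  simp only [elasticForm]
  rw [← integral_add (integrable_elasticDensity M f h) (integrable_elasticDensity M g h)]
  refine integral_congr_ae ?_
  filter_upwards [ae_all_iff.2 (coeFn_grad_add f g)] with x hx
  simp only [elasticDensity, divergence, strain, hx, PiLp.add_apply, Fin.sum_univ_three,
    Complex.star_def, map_add, map_div₀]
  ring

theorem elasticForm_smul_left (M : Medium) (c : ℂ) (f h : H1) :
    elasticForm M (c • f) h = star c * elasticForm M f h := by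
  simp only [elasticForm]
  rw [← integral_const_mul]
  refine integral_congr_ae ?_
  filter_upwards [ae_all_iff.2 (coeFn_grad_smul c f)] with x hx
  simp only [elasticDensity, divergence, strain, hx, PiLp.smul_apply, Fin.sum_univ_three,
    Complex.star_def, map_add, map_div₀, smul_eq_mul, map_mul]
  ring

/-- Cauchy data `(h₀, h₁) ∈ H¹(ℝ³; ℂ³) ⊕ L²(ℝ³; ℂ³)`, to be equipped with the energy norm of the
medium. -/
def CauchyData (_M : Medium) : Type := H1 × L2

instance (M : Medium) : AddCommGroup (CauchyData M) := inferInstanceAs (AddCommGroup (H1 × L2))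

instance (M : Medium) : Module ℂ (CauchyData M) := inferInstanceAs (Module ℂ (H1 × L2))

/-- The elastic energy inner product
`⟨f, g⟩ = ∫ (conj(f₁) · g₁ + λ conj(div f₀) div g₀ + 2 μ conj(∇̂f₀) : ∇̂g₀) dx`
(conjugate linear in the first argument, as everywhere in Mathlib). -/
instance energyCore (M : Medium) : PreInnerProductSpace.Core ℂ (CauchyData M) where
  inner f g := inner ℂ f.2 g.2 + elasticForm M f.1 g.1
  conj_inner_symm f g := by
    have := elasticForm_conj M f.1 g.1
    simp only [map_add, inner_conj_symm]
    rw [← this]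
    rfl
  re_inner_nonneg f := by
    have h1 := elasticForm_re_nonneg M f.1
    have h2 : 0 ≤ RCLike.re (inner ℂ f.2 f.2) := inner_self_nonneg
    simp only [map_add]
    exact add_nonneg h2 h1
  add_left f g h := by
    have := elasticForm_add_left M f.1 g.1 h.1
    have h2 : inner ℂ (f.2 + g.2) h.2 = inner ℂ f.2 h.2 + inner ℂ g.2 h.2 := inner_add_left _ _ _
    change inner ℂ (f.2 + g.2) h.2 + elasticForm M (f.1 + g.1) h.1 = _
    rw [this, h2]
    ring
  smul_left f g c := by
    have := elasticForm_smul_left M c f.1 g.1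
    have h2 : inner ℂ (c • f.2) g.2 = star c * inner ℂ f.2 g.2 := inner_smul_left _ _ _
    change inner ℂ (c • f.2) g.2 + elasticForm M (c • f.1) g.1 = _
    rw [this, h2]
    simp only [Complex.star_def]
    ring

instance (M : Medium) : SeminormedAddCommGroup (CauchyData M) :=
  InnerProductSpace.Core.toSeminormedAddCommGroup (𝕜 := ℂ)

instance (M : Medium) : InnerProductSpace ℂ (CauchyData M) :=
  InnerProductSpace.ofCore (energyCore M)

/-- The energy space: the Hilbert space completion of the Cauchy data in the energy norm. -/
abbrev EnergySpace (M : Medium) : Type := Completion (CauchyData M)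

/-- The data `H¹₀(U) ⊕ L²(U)` as a closed subspace of the energy space. (For bounded `U` the
energy norm is equivalent to the norm of `H¹ ⊕ L²` on it, and the closure adds nothing.) -/
def dataOn (M : Medium) (U : Set R3) : Submodule ℂ (EnergySpace M) :=
  (Submodule.map (Completion.toComplL (𝕜 := ℂ) (E := CauchyData M)).toLinearMap
    ((H10 U).prod (L2on U) : Submodule ℂ (H1 × L2))).topologicalClosure

/-! ### The elastic wave equation -/

/-- `t ↦ (u t, v t)` is a finite energy solution of `∂ₜ² u = L u` on `ℝ × ℝ³` and its velocity:
`u ∈ C(ℝ; H¹) ∩ C¹(ℝ; L²)`, `v = ∂ₜ u`, and `d/dt (∂ₜ u, w) = -a(u, w)` for every `w ∈ H¹`. -/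
structure IsWave (M : Medium) (U : ℝ → H1 × L2) : Prop where
  continuous : Continuous U
  velocity : ∀ t, HasDerivAt (fun s => (U s).1.1.1) (U t).2 t
  equation : ∀ w : H1, ∀ t,
    HasDerivAt (fun s => inner ℂ w.1.1 (U s).2) (-(elasticForm M w (U t).1)) t

open Classical in
/-- The propagator on Cauchy data: it takes the data at time `0` of a wave to its data at time
`t`. (Existence and uniqueness of the wave are a theorem; the alternative never occurs.) -/
def propagate (M : Medium) (t : ℝ) (h : CauchyData M) : CauchyData M :=
  if hU : ∃ U : ℝ → H1 × L2, IsWave M U ∧ U 0 = h then hU.choose t else 0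

/-- The propagator `R_t` on the energy space, the continuous extension of `propagate`. -/
def propagator (M : Medium) (t : ℝ) : EnergySpace M → EnergySpace M :=
  Completion.map (propagate M t)

/-- Time reversal `ν (f₀, f₁) = (f₀, -f₁)` of Cauchy data. -/
def reverseData (M : Medium) (h : CauchyData M) : CauchyData M := (h.1, -h.2)

/-- Time reversal `ν` on the energy space. -/
def timeReversal (M : Medium) : EnergySpace M → EnergySpace M :=
  Completion.map (reverseData M)

/-! ### Scattering control -/

/-- A pulse region `Θ` inside a control region `Υ`, in an elastic medium, and half the measurement
time `T`. -/
structure Setup where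
  medium : Medium
  Θ : Set R3
  Υ : Set R3
  T : ℝ
  isOpen_Θ : IsOpen Θ
  isOpen_Υ : IsOpen Υ
  closure_subset : closure Θ ⊆ Υ
  T_pos : 0 < T

namespace Setup

variable (S : Setup)

/-- The energy space of the medium. -/
abbrev E : Type := EnergySpace S.medium

/-- `R_t`. -/
abbrev Rt (t : ℝ) : S.E → S.E := propagator S.medium t

/-- Time reversal. -/
abbrev ν : S.E → S.E := timeReversal S.medium

/-- `R = ν ∘ R_{2T}`. -/
def R (h : S.E) : S.E := S.ν (S.Rt (2 * S.T) h)

/-- `H = H¹₀(Θ) ⊕ L²(Θ)`. -/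
def H : Submodule ℂ S.E := dataOn S.medium S.Θ

/-- The control data before the trivial ones are removed, `H¹₀(Θ⋆) ⊕ L²(Θ⋆)`, where
`Θ⋆ = Υ \ closure Θ`. -/
def HstarTilde : Submodule ℂ S.E := dataOn S.medium (S.Υ \ closure S.Θ)

/-- All data in the control region, `H¹₀(Υ) ⊕ L²(Υ)`. -/
def CTilde : Submodule ℂ S.E := dataOn S.medium S.Υ

/-- The trivial data: those in `Υ` whose wave fields vanish on `Θ` (and are again in `Υ`) at both
times `0` and `2T`. The set is itself a closed subspace, `R_{2T}` being linear and isometric; the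
span is there only so that this need not be known in advance. -/
def G : Submodule ℂ S.E :=
  Submodule.span ℂ {g : S.E | g ∈ S.HstarTilde ∧ S.Rt (2 * S.T) g ∈ S.HstarTilde}

/-- The orthogonal complement of the trivial data inside the data in `Υ`. -/
def C : Submodule ℂ S.E := S.CTilde ⊓ S.Gᗮ

/-- The control data: the orthogonal complement of the trivial data inside
`H¹₀(Θ⋆) ⊕ L²(Θ⋆)`. -/
def Hstar : Submodule ℂ S.E := S.HstarTilde ⊓ S.Gᗮ

instance : CompleteSpace S.HstarTilde := by
  unfold HstarTilde dataOn
  infer_instance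

/-- `π⋆`, the orthogonal projection onto `H¹₀(Θ⋆) ⊕ L²(Θ⋆)`. It is defined on the whole energy
space, since waves may leave `Υ`; on `C` it is the orthogonal projection of `C` onto `Hstar`, as
`piStar_mem_Hstar` and `sub_piStar_mem_orthogonal` show. -/
def piStar : S.E →L[ℂ] S.E := S.HstarTilde.starProjection

/-- `π̄ = Id - π⋆`. -/
def piBar : S.E →L[ℂ] S.E := ContinuousLinearMap.id ℂ S.E - S.piStar

theorem G_le : S.G ≤ S.HstarTilde := Submodule.span_le.2 fun _ hg => hg.1

theorem piStar_mem_Hstar {h : S.E} (hh : h ∈ S.C) : S.piStar h ∈ S.Hstar := by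
  refine ⟨Submodule.starProjection_apply_mem _ _, ?_⟩
  have h1 : h - S.piStar h ∈ S.Gᗮ :=
    Submodule.orthogonal_le S.G_le (Submodule.sub_starProjection_mem_orthogonal h)
  simpa using S.Gᗮ.sub_mem hh.2 h1

theorem sub_piStar_mem_orthogonal (h : S.E) : h - S.piStar h ∈ S.Hstarᗮ :=
  Submodule.orthogonal_le inf_le_left (Submodule.sub_starProjection_mem_orthogonal h)

/-- `Im(R_T π⋆)`, with `π⋆` acting on `C`. (The image of the linear map `R_T π⋆` is its own span.) -/
def imForward : Submodule ℂ S.E :=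
  Submodule.span ℂ ((fun k => S.Rt S.T (S.piStar k)) '' S.C)

/-- `Im(ν R_T π⋆)`. -/
def imReversed : Submodule ℂ S.E :=
  Submodule.span ℂ ((fun k => S.ν (S.Rt S.T (S.piStar k))) '' S.C)

/-- `Im(R_{-T} π⋆)`. -/
def imBackward : Submodule ℂ S.E :=
  Submodule.span ℂ ((fun k => S.Rt (-S.T) (S.piStar k)) '' S.C)

/-- The controllable subspace, the closure of `Im(R_T π⋆) + Im(ν R_T π⋆)`. -/
def controllable : Submodule ℂ S.E := (S.imForward ⊔ S.imReversed).topologicalClosure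

instance : CompleteSpace S.controllable := by
  unfold controllable
  infer_instance

/-- The scattering control equation `(I - π⋆ R π⋆ R) h = h₀`. -/
def ScatteringControl (h₀ h : S.E) : Prop :=
  h - S.piStar (S.R (S.piStar (S.R h))) = h₀

end Setup

end ElasticScattering

end

open ElasticScattering

open MeasureTheory UniformSpace
open scoped ContDiff

noncomputable section

namespace ElasticScattering

/-! ### Energy conservation -/

/-! The lemma is Hilbert space geometry once four facts are known: `R_t` is a unitary group, `ν` is
a unitary involution with `ν R_t = R_{-t} ν`, `ν` commutes with `π⋆`, and `π⋆` kills data in `Θ`.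
Put `w = R_{-T} π̄ R_{2T} h`. Since `R_T w` lies in the range of `π̄`, `w` is always orthogonal to
`R_{-T} π⋆`, and hence to `ν R_T π⋆ = R_{-T} ν π⋆`. The two reversals in `π⋆ R π⋆ R` cancel, which
turns the control equation into `(h - π⋆ h) + π⋆ R_{-T} w = h₀`. As `π⋆ h₀ = 0`, it splits into `h -
π⋆ h = h₀` and `π⋆ R_{-T} w = 0` (`scatteringControl_iff_and`). The second equation makes `w`
orthogonal to `Im(R_T π⋆)`, while `R_T h₀ - w = ν R_T π⋆ R h - R_T π⋆ h` is controllable; so `w` is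
the projection of `R_T h₀`. Conversely, orthogonality to `Im(R_T π⋆)` tests `R_{-T} w` only against
`Hstar`, and the missing directions `G` are free: `R_{2T}` maps the data spanning `G` into the range
of `π⋆`.

Most of the work is to show that the propagator is such a group, for coefficients that are merely
bounded and measurable. Energy conservation follows from invariance of the symplectic form
(`energy_eq`). Korn's inequality, with integration by parts done by translations in `L²`, makes the
energy control the gradient. For existence, the generator is cut off spectrally, which leaves a
bounded linear system; the resulting waves have dense data (`exists_abstractWave_near`), and a bound
growing linearly in time passes to general data (`exists_wave`). -/

theorem hasDerivAt_inner_of_weak {H : Type*} [NormedAddCommGroup H] [InnerProductSpace ℂ H]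
    {x y : ℝ → H} {y' : H} {c : ℂ} {t : ℝ} (hx : ContinuousAt x t) (hy : HasDerivAt y y' t)
    (hc : HasDerivAt (fun s => inner ℂ (y t) (x s)) c t) :
    HasDerivAt (fun s => inner ℂ (y s) (x s)) (c + inner ℂ y' (x t)) t := by
  -- Only continuity of `x` is available, so the product rule does not apply. But `y s - y t`
  -- vanishes at `t`, so the slope of this product is the inner product of the slope of `y` with `x
  -- s`, and it converges.
  have h2 : HasDerivAt (fun s => inner ℂ (y s - y t) (x s)) (inner ℂ y' (x t)) t := by
    rw [hasDerivAt_iff_tendsto_slope] at hy ⊢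
    have := hy.inner (𝕜 := ℂ) (hx.tendsto.mono_left nhdsWithin_le_nhds)
    refine this.congr fun s => ?_
    simp only [slope, vsub_eq_sub, sub_self, inner_zero_left, sub_zero]
    rw [← Complex.coe_smul (s - t)⁻¹ (y s - y t), inner_smul_left, Complex.conj_ofReal,
      Complex.real_smul]
  refine (hc.add h2).congr_of_eventuallyEq (Filter.Eventually.of_forall fun s => ?_)
  simp

namespace IsWave

variable {M : Medium} {U W : ℝ → H1 × L2}

theorem continuous_velocity (hU : IsWave M U) : Continuous fun t => (U t).2 :=
  continuous_snd.comp hU.continuous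

theorem hasDerivAt_inner_shift (hU : IsWave M U) (q p s : ℝ) :
    HasDerivAt (fun r => inner ℂ (U (q + r)).1.1.1 (U (p + r)).2)
      (-(elasticForm M (U (q + s)).1 (U (p + s)).1) +
        inner ℂ (U (q + s)).2 (U (p + s)).2) s := by
  refine hasDerivAt_inner_of_weak (x := fun r => (U (p + r)).2) (y := fun r => (U (q + r)).1.1.1)
    ?_ ?_ ?_
  · exact (hU.continuous_velocity.comp (continuous_const.add continuous_id)).continuousAt
  · exact (hU.velocity (q + s)).comp_const_add q s
  · exact (hU.equation (U (q + s)).1 (p + s)).comp_const_add p s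

/-- The velocity is only in `L²`, so it cannot be inserted into the form to differentiate the energy
directly. The symplectic form of two time shifts of one wave involves displacements only as test
fields; in its derivative the elastic and kinetic terms cancel by Hermitian symmetry. -/
theorem symplectic_shift (hU : IsWave M U) (q p s : ℝ) :
    inner ℂ (U (q + s)).1.1.1 (U (p + s)).2 - inner ℂ (U (q + s)).2 (U (p + s)).1.1.1 =
      inner ℂ (U q).1.1.1 (U p).2 - inner ℂ (U q).2 (U p).1.1.1 := by
  have key : ∀ s, HasDerivAt (fun r => inner ℂ (U (q + r)).1.1.1 (U (p + r)).2 -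
      inner ℂ (U (q + r)).2 (U (p + r)).1.1.1) 0 s := by
    intro s
    have h1 := hU.hasDerivAt_inner_shift q p s
    have h2 := (hU.hasDerivAt_inner_shift p q s).star
    have h3 := h1.sub h2
    have e : (-(elasticForm M (U (q + s)).1 (U (p + s)).1) +
        inner ℂ (U (q + s)).2 (U (p + s)).2) -
        star (-(elasticForm M (U (p + s)).1 (U (q + s)).1) +
        inner ℂ (U (p + s)).2 (U (q + s)).2) = 0 := by
      rw [star_add, star_neg, elasticForm_conj]
      simp
    rw [e] at h3
    refine h3.congr_of_eventuallyEq (Filter.Eventually.of_forall fun r => ?_)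
    simp
  have := is_const_of_deriv_eq_zero (fun s => (key s).differentiableAt) (fun s => (key s).deriv) s 0
  simpa using this

/-- Minus the energy at time `t` is the derivative at `s = 0` of the symplectic form of `U t` and `U
(t + s)`, and for each `s` that form does not depend on `t`. -/
theorem energy_eq (hU : IsWave M U) (t : ℝ) :
    inner ℂ (U t).2 (U t).2 + elasticForm M (U t).1 (U t).1 =
      inner ℂ (U 0).2 (U 0).2 + elasticForm M (U 0).1 (U 0).1 := by
  have key : ∀ t, HasDerivAt (fun s => inner ℂ (U t).1.1.1 (U (t + s)).2 -
      inner ℂ (U t).2 (U (t + s)).1.1.1)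
      (-(inner ℂ (U t).2 (U t).2 + elasticForm M (U t).1 (U t).1)) 0 := by
    intro t
    have h1 := (hU.equation (U t).1 (t + 0)).comp_const_add t 0
    have h2 := ((hasDerivAt_const (0 : ℝ) (U t).2).inner ℂ
      ((hU.velocity (t + 0)).comp_const_add t 0))
    refine (h1.sub h2).congr_deriv ?_
    simp only [add_zero, inner_zero_left]
    ring
  have h := (key 0).congr_of_eventuallyEq (f₁ := fun s => inner ℂ (U t).1.1.1 (U (t + s)).2 -
      inner ℂ (U t).2 (U (t + s)).1.1.1) (Filter.Eventually.of_forall fun s => ?_)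
  · exact neg_injective ((key t).unique h)
  · have := hU.symplectic_shift 0 (0 + s) t
    simp only [zero_add] at this ⊢
    rw [add_comm s t] at this
    exact this

theorem norm_eq (hU : IsWave M U) (t : ℝ) :
    ‖(show CauchyData M from U t)‖ = ‖(show CauchyData M from U 0)‖ := by
  have h := hU.energy_eq t
  have h' : inner ℂ (show CauchyData M from U t) (show CauchyData M from U t) =
    inner ℂ (show CauchyData M from U 0) (show CauchyData M from U 0) := h
  rw [norm_eq_sqrt_re_inner (𝕜 := ℂ), norm_eq_sqrt_re_inner (𝕜 := ℂ), h']

/-! ### The space of waves -/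

theorem _root_.ElasticScattering.elasticForm_add_right (M : Medium) (f g h : H1) :
    elasticForm M f (g + h) = elasticForm M f g + elasticForm M f h := by
  rw [← elasticForm_conj M f, elasticForm_add_left, star_add, elasticForm_conj, elasticForm_conj]

theorem _root_.ElasticScattering.elasticForm_smul_right (M : Medium) (c : ℂ) (f g : H1) :
    elasticForm M f (c • g) = c * elasticForm M f g := by
  rw [← elasticForm_conj M f, elasticForm_smul_left, star_mul', elasticForm_conj, star_star]

theorem add (hU : IsWave M U) (hW : IsWave M W) : IsWave M (U + W) where
  continuous := hU.continuous.add hW.continuous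
  velocity t := (hU.velocity t).add (hW.velocity t)
  equation w t := by
    refine (((hU.equation w t).add (hW.equation w t)).congr_deriv ?_).congr_of_eventuallyEq
      (Filter.Eventually.of_forall fun s => ?_)
    · rw [Pi.add_apply, Prod.fst_add, elasticForm_add_right]
      ring
    · exact inner_add_right _ _ _

theorem smul (c : ℂ) (hU : IsWave M U) : IsWave M (c • U) where
  continuous := hU.continuous.const_smul c
  velocity t := (hU.velocity t).const_smul c
  equation w t := by
    refine (((hU.equation w t).const_mul c).congr_deriv ?_).congr_of_eventuallyEq
      (Filter.Eventually.of_forall fun s => ?_)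
    · rw [Pi.smul_apply, Prod.smul_fst, elasticForm_smul_right]
      ring
    · exact inner_smul_right _ _ _

theorem sub (hU : IsWave M U) (hW : IsWave M W) : IsWave M (U - W) := by
  have e : U - W = U + (-1 : ℂ) • W := by
    funext t
    change U t - W t = U t + (-1 : ℂ) • W t
    have h : (-1 : ℂ) • W t = -W t := neg_one_smul ℂ (W t)
    rw [h, sub_eq_add_neg]
  exact e ▸ hU.add (hW.smul (-1))

theorem shift (hU : IsWave M U) (r : ℝ) : IsWave M fun t => U (r + t) where
  continuous := hU.continuous.comp (continuous_const.add continuous_id)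
  velocity t := (hU.velocity (r + t)).comp_const_add r t
  equation w t := (hU.equation w (r + t)).comp_const_add r t

theorem reverse (hU : IsWave M U) : IsWave M fun t => ((U (-t)).1, -(U (-t)).2) where
  continuous := by
    have := hU.continuous.comp continuous_neg
    exact (continuous_fst.comp this).prodMk (continuous_snd.comp this).neg
  velocity t := by
    have := (hU.velocity (-t)).scomp t (hasDerivAt_neg t)
    simpa [Function.comp_def] using this
  equation w t := by
    refine (((hU.equation w (-t)).scomp t (hasDerivAt_neg t)).neg.congr_deriv
      ?_).congr_of_eventuallyEq (Filter.Eventually.of_forall fun s => ?_)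
    · simp
    · simp

theorem norm_sub_eq (hU : IsWave M U) (hW : IsWave M W) (t : ℝ) :
    ‖(show CauchyData M from U t) - (show CauchyData M from W t)‖ =
      ‖(show CauchyData M from U 0) - (show CauchyData M from W 0)‖ :=
  (hU.sub hW).norm_eq t

end IsWave

/-! ### Translations in `L²` -/

section Translation

variable {F : Type*} [NormedAddCommGroup F] [InnerProductSpace ℂ F]

/-- Translation `(τ_y f)(x) = f(x + y)` on `L²`. -/
def translate (y : R3) : Lp F 2 (volume : Measure R3) →ₗᵢ[ℂ] Lp F 2 (volume : Measure R3) :=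
  Lp.compMeasurePreservingₗᵢ ℂ (fun x => x + y) (measurePreserving_add_right volume y)

theorem coeFn_translate (y : R3) (f : Lp F 2 (volume : Measure R3)) :
    translate y f =ᵐ[volume] fun x => f (x + y) :=
  Lp.coeFn_compMeasurePreserving _ _

theorem translate_translate (y z : R3) (f : Lp F 2 (volume : Measure R3)) :
    translate y (translate z f) = translate (y + z) f := by
  refine Lp.ext ?_
  have h := (measurePreserving_add_right volume y).quasiMeasurePreserving.ae_eq_comp
    (coeFn_translate z f)
  filter_upwards [coeFn_translate y (translate z f), h, coeFn_translate (y + z) f] with x h1 h2 h3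
  rw [h1, h3]
  simpa [Function.comp_def, add_assoc] using h2

theorem translate_zero (f : Lp F 2 (volume : Measure R3)) : translate 0 f = f := by
  refine Lp.ext ?_
  filter_upwards [coeFn_translate 0 f] with x h1
  rw [h1, add_zero]

theorem inner_translate_translate (y z : R3) (p q : Lp F 2 (volume : Measure R3)) :
    inner ℂ (translate y p) (translate z q) = inner ℂ (translate (-z) p) (translate (-y) q) := by
  rw [← (translate (-z + -y)).inner_map_map, translate_translate, translate_translate]
  simp

theorem inner_translate_left (y : R3) (p q : Lp F 2 (volume : Measure R3)) :
    inner ℂ (translate y p) q = inner ℂ p (translate (-y) q) := by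
  simpa [translate_zero] using inner_translate_translate y 0 p q

theorem continuous_translate (f : Lp F 2 (volume : Measure R3)) :
    Continuous fun y : R3 => translate y f := by
  have : Fact ((2 : ENNReal) ≠ ⊤) := ⟨by norm_num⟩
  have : Continuous fun y : R3 => (DomAddAct.mk y +ᵥ f : Lp F 2 (volume : Measure R3)) :=
    (DomAddAct.mkHomeomorph.continuous).vadd continuous_const
  refine this.congr fun y => Lp.ext ?_
  filter_upwards [DomAddAct.vadd_Lp_ae_eq (DomAddAct.mk y) f, coeFn_translate y f] with x h1 h2
  rw [h1, h2, add_comm]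
  rfl

/-- `p'` is the derivative of `p` in the direction `e` in `L²`. -/
def HasL2Deriv (e : R3) (p p' : Lp F 2 (volume : Measure R3)) : Prop :=
  HasDerivAt (fun s : ℝ => translate (s • e) p) p' 0

/-- This is two integrations by parts without second derivatives. At the level of difference
quotients the translations by `s • e` and `s • e'` change sides exactly, both with reversed sign,
and the signs cancel in the limit. -/
theorem HasL2Deriv.inner_swap {e e' : R3} {p p₁ p₂ q q₁ q₂ : Lp F 2 (volume : Measure R3)}
    (hp₁ : HasL2Deriv e p p₁) (hp₂ : HasL2Deriv e' p p₂) (hq₁ : HasL2Deriv e q q₁)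
    (hq₂ : HasL2Deriv e' q q₂) : inner ℂ p₁ q₂ = inner ℂ p₂ q₁ := by
  have hneg : ∀ {d : R3} {r r' : Lp F 2 (volume : Measure R3)}, HasL2Deriv d r r' →
      HasDerivAt (fun s : ℝ => translate (-(s • d)) r) (-r') 0 := by
    intro d r r' h
    have h' : HasDerivAt (fun s : ℝ => translate (s • d) r) r' (-0) := by
      rw [neg_zero]
      exact h
    simpa [Function.comp_def] using h'.scomp (0 : ℝ) (hasDerivAt_neg 0)
  have h1 := (hasDerivAt_iff_tendsto_slope.1 hp₁).inner (𝕜 := ℂ)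
    (hasDerivAt_iff_tendsto_slope.1 hq₂)
  have h2 := (hasDerivAt_iff_tendsto_slope.1 (hneg hp₂)).inner (𝕜 := ℂ)
    (hasDerivAt_iff_tendsto_slope.1 (hneg hq₁))
  rw [inner_neg_neg] at h2
  refine tendsto_nhds_unique h1 (h2.congr fun s => ?_)
  simp only [slope, vsub_eq_sub, sub_zero, zero_smul, neg_zero, translate_zero]
  simp only [RCLike.real_smul_eq_coe_smul (K := ℂ), inner_smul_left, inner_smul_right]
  congr 2
  simp only [inner_sub_left, inner_sub_right]
  rw [inner_translate_translate (s • e), inner_translate_left (s • e) p q,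
    inner_translate_left (-(s • e')) p q, neg_neg]
  ring

end Translation

/-! ### Weak derivatives are strong derivatives -/

theorem IsTest.translate {φ : R3 → ℝ} (hφ : IsTest φ) (y : R3) : IsTest fun x => φ (x - y) :=
  ⟨hφ.1.comp (contDiff_id.sub contDiff_const),
    hφ.2.comp_homeomorph (Homeomorph.subRight y)⟩

theorem partialDeriv_comp_sub (j : Fin 3) (φ : R3 → ℝ) (y x : R3) :
    partialDeriv j (fun x => φ (x - y)) x = partialDeriv j φ (x - y) := by
  simp only [partialDeriv, fderiv_comp_sub]

theorem integral_smul_L2_add {φ : R3 → ℝ} (hφ : IsTest φ) (f g : L2) :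
    ∫ x, φ x • (f + g : L2) x = (∫ x, φ x • f x) + ∫ x, φ x • g x := by
  rw [← integral_add (hφ.integrable_smul f) (hφ.integrable_smul g)]
  refine integral_congr_ae ?_
  filter_upwards [Lp.coeFn_add f g] with x hx
  rw [hx, Pi.add_apply, smul_add]

theorem integral_smul_L2_smul (φ : R3 → ℝ) (c : ℂ) (f : L2) :
    ∫ x, φ x • (c • f : L2) x = c • ∫ x, φ x • f x := by
  rw [← integral_smul]
  refine integral_congr_ae ?_
  filter_upwards [Lp.coeFn_smul c f] with x hx
  rw [hx, Pi.smul_apply, smul_comm]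

theorem norm_integral_smul_L2_le {φ : R3 → ℝ} (hφ : IsTest φ) (f : L2) :
    ‖∫ x, φ x • f x‖ ≤ (eLpNorm φ 2 volume).toReal * ‖f‖ := by
  have hφ' : MemLp φ 2 volume := hφ.1.continuous.memLp_of_hasCompactSupport hφ.2
  have h1 : ‖∫ x, φ x • f x‖ ≤ (eLpNorm (fun x => φ x • f x) 1 volume).toReal := by
    refine (norm_integral_le_integral_norm _).trans ?_
    rw [eLpNorm_one_eq_lintegral_enorm, integral_norm_eq_lintegral_enorm
      (hφ.integrable_smul f).aestronglyMeasurable]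
  have h2 : eLpNorm (fun x => φ x • f x) 1 volume ≤
      eLpNorm φ 2 volume * eLpNorm f 2 volume := by
    have := eLpNorm_smul_le_mul_eLpNorm (p := 2) (q := 2) (r := 1) (Lp.memLp f).1 hφ'.1
    exact this
  refine h1.trans ?_
  rw [Lp.norm_def, ← ENNReal.toReal_mul]
  exact ENNReal.toReal_mono (ENNReal.mul_ne_top hφ'.2.ne (Lp.memLp f).2.ne) h2

/-- Integration against a test function. -/
def testPairing (φ : R3 → ℝ) (hφ : IsTest φ) : L2 →L[ℂ] C3 :=
  LinearMap.mkContinuous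
    { toFun := fun f => ∫ x, φ x • f x
      map_add' := integral_smul_L2_add hφ
      map_smul' := integral_smul_L2_smul φ }
    ((eLpNorm φ 2 volume).toReal) (norm_integral_smul_L2_le hφ)

theorem testPairing_apply (φ : R3 → ℝ) (hφ : IsTest φ) (f : L2) :
    testPairing φ hφ f = ∫ x, φ x • f x := rfl

theorem eq_zero_of_testPairing (f : L2) (h : ∀ φ hφ, testPairing φ hφ f = 0) : f = 0 := by
  refine Lp.ext ?_
  have := ae_eq_zero_of_integral_contDiff_smul_eq_zero (μ := volume) (f := (f : R3 → C3))
    ((Lp.memLp f).locallyIntegrable (by norm_num)) fun g h1 h2 => h g ⟨h1, h2⟩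
  filter_upwards [this, Lp.coeFn_zero C3 2 (volume : Measure R3)] with x hx h0
  rw [hx, h0, Pi.zero_apply]

theorem testPairing_translate (φ : R3 → ℝ) (hφ : IsTest φ) (y : R3) (f : L2) :
    testPairing φ hφ (translate y f) = ∫ x, φ (x - y) • f x := by
  rw [testPairing_apply, ← integral_add_right_eq_self (fun x => φ (x - y) • f x) y]
  refine integral_congr_ae ?_
  filter_upwards [coeFn_translate y f] with x hx
  rw [hx, add_sub_cancel_right]

theorem hasDerivAt_testPairing_translate {j : Fin 3} {f g : L2} (hfg : IsWeakPartial j f g)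
    (φ : R3 → ℝ) (hφ : IsTest φ) (s : ℝ) :
    HasDerivAt (fun s : ℝ => testPairing φ hφ
      (translate (s • (EuclideanSpace.single j 1 : R3)) f))
      (testPairing φ hφ (translate (s • (EuclideanSpace.single j 1 : R3)) g)) s := by
  set e : R3 := EuclideanSpace.single j 1 with he
  simp only [testPairing_translate]
  -- As a function of the shift `y`, the pairing `∫ φ (x - y) • f x` is the convolution of `f` with
  -- the reflection `z ↦ φ (-z)`, so the derivative falls on the smooth factor.
  have hc : HasCompactSupport fun z : R3 => φ (-z) :=
    hφ.2.comp_homeomorph (Homeomorph.neg R3)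
  have hd : ContDiff ℝ 1 fun z : R3 => φ (-z) :=
    (hφ.1.comp contDiff_neg).of_le (by exact_mod_cast le_top)
  have hloc : LocallyIntegrable (f : R3 → C3) volume :=
    (Lp.memLp f).locallyIntegrable (by norm_num)
  have h := hc.hasFDerivAt_convolution_right (μ := volume)
    (ContinuousLinearMap.lsmul ℝ ℝ : ℝ →L[ℝ] C3 →L[ℝ] C3).flip hloc hd (s • e)
  have h2 := h.comp_hasDerivAt s ((hasDerivAt_id s).smul_const e)
  rw [convolution_precompR_apply _ hloc (hc.fderiv ℝ) (hd.continuous_fderiv one_ne_zero)] at h2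
  refine (h2.congr_deriv ?_).congr_of_eventuallyEq (Filter.Eventually.of_forall fun r => ?_)
  · have h3 := hfg _ (hφ.translate (s • e))
    simp only [partialDeriv_comp_sub] at h3
    have h4 : ∫ x, φ (x - s • e) • g x = -∫ x, partialDeriv j φ (x - s • e) • f x := by
      rw [h3, neg_neg]
    rw [h4, convolution, ← integral_neg]
    refine integral_congr_ae (Filter.Eventually.of_forall fun x => ?_)
    simp only [ContinuousLinearMap.flip_apply, ContinuousLinearMap.lsmul_apply, one_smul]
    have hz : ∀ z, fderiv ℝ (fun z : R3 => φ (-z)) z = -fderiv ℝ φ (-z) := fun z => by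
      have h5 := (((hφ.1.differentiable (by simp)) (-z)).hasFDerivAt.comp z
        (hasFDerivAt_id z).neg).fderiv
      simpa [Function.comp_def] using h5
    rw [hz]
    simp [partialDeriv, he]
  · simp [convolution]

/-- A weak partial derivative in `L²` is a strong one. -/
theorem IsWeakPartial.hasL2Deriv {j : Fin 3} {f g : L2} (hfg : IsWeakPartial j f g) :
    HasL2Deriv (EuclideanSpace.single j 1) f g := by
  set e : R3 := EuclideanSpace.single j 1 with he
  have hcont : Continuous fun s : ℝ => translate (s • e) g :=
    (continuous_translate g).comp (continuous_id.smul continuous_const)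
  have hI : ∀ s, HasDerivAt (fun s => ∫ r in (0 : ℝ)..s, translate (r • e) g)
      (translate (s • e) g) s := fun s => hcont.integral_hasStrictDerivAt 0 s |>.hasDerivAt
  -- The fundamental theorem of calculus along the translation orbit: paired with any test function,
  -- both sides have the same derivative in `s`, and they agree at `s = 0`.
  have key : ∀ s : ℝ, translate (s • e) f = f + ∫ r in (0 : ℝ)..s, translate (r • e) g := by
    intro s
    rw [← sub_eq_zero]
    refine eq_zero_of_testPairing _ fun φ hφ => ?_
    have hd : ∀ s, HasDerivAt (fun s : ℝ => testPairing φ hφ (translate (s • e) f) -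
        testPairing φ hφ (∫ r in (0 : ℝ)..s, translate (r • e) g)) 0 s := by
      intro s
      have h1 := hasDerivAt_testPairing_translate hfg φ hφ s
      have h2 := ((testPairing φ hφ).restrictScalars ℝ).hasFDerivAt.comp_hasDerivAt s (hI s)
      exact (h1.sub h2).congr_deriv (sub_self _)
    have := is_const_of_deriv_eq_zero (fun s => (hd s).differentiableAt)
      (fun s => (hd s).deriv) s 0
    simp only [zero_smul, translate_zero, intervalIntegral.integral_same, map_zero,
      sub_zero] at this
    rw [map_sub, map_add, ← this]
    abel
  have h0 : HasDerivAt (fun s : ℝ => f + ∫ r in (0 : ℝ)..s, translate (r • e) g) g 0 := by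
    have := (hI 0).const_add f
    rwa [zero_smul, translate_zero] at this
  exact h0.congr_of_eventuallyEq (Filter.Eventually.of_forall key)

/-! ### Korn's inequality -/

/-- The `j`-th coordinate of an `L²` field. -/
def coord (j : Fin 3) : L2 →L[ℂ] Lp ℂ 2 (volume : Measure R3) :=
  (EuclideanSpace.proj (𝕜 := ℂ) j : C3 →L[ℂ] ℂ).compLpL 2 volume

theorem coeFn_coord (j : Fin 3) (f : L2) : coord j f =ᵐ[volume] fun x => f x j :=
  (EuclideanSpace.proj (𝕜 := ℂ) j : C3 →L[ℂ] ℂ).coeFn_compLpL f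

theorem translate_coord (j : Fin 3) (y : R3) (f : L2) :
    translate y (coord j f) = coord j (translate y f) := by
  refine Lp.ext ?_
  have h := (measurePreserving_add_right volume y).quasiMeasurePreserving.ae_eq_comp
    (coeFn_coord j f)
  filter_upwards [coeFn_translate y (coord j f), h, coeFn_coord j (translate y f),
    coeFn_translate y f] with x h1 h2 h3 h4
  rw [h1, h3, h4]
  exact h2

theorem HasL2Deriv.coord {e : R3} {f g : L2} (h : HasL2Deriv e f g) (j : Fin 3) :
    HasL2Deriv e (coord j f) (coord j g) := by
  have := ((ElasticScattering.coord j).restrictScalars ℝ).hasFDerivAt.comp_hasDerivAt 0 h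
  exact this.congr_of_eventuallyEq (Filter.Eventually.of_forall fun s => translate_coord j _ f)

theorem L2_norm_sq {F : Type*} [NormedAddCommGroup F] [InnerProductSpace ℂ F]
    (p : Lp F 2 (volume : Measure R3)) : ‖p‖ ^ 2 = ∫ x, ‖p x‖ ^ 2 := by
  have h1 : RCLike.re (inner ℂ p p) = ‖p‖ ^ 2 := inner_self_eq_norm_sq p
  rw [← h1, MeasureTheory.L2.inner_def, ← integral_re (L2.integrable_inner p p)]
  refine integral_congr_ae (Filter.Eventually.of_forall fun x => ?_)
  exact inner_self_eq_norm_sq (𝕜 := ℂ) (p x)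

theorem L2_integrable_norm_sq {F : Type*} [NormedAddCommGroup F] [InnerProductSpace ℂ F]
    (p : Lp F 2 (volume : Measure R3)) : Integrable (fun x => ‖p x‖ ^ 2) volume :=
  (Lp.memLp p).integrable_norm_pow (by norm_num)

theorem norm_sq_eq_sum_coord (f : L2) : ‖f‖ ^ 2 = ∑ j, ‖coord j f‖ ^ 2 := by
  simp only [L2_norm_sq]
  rw [← integral_finsetSum _ fun j _ => L2_integrable_norm_sq _]
  refine integral_congr_ae ?_
  filter_upwards [ae_all_iff.2 fun j => coeFn_coord j f] with x hx
  simp only [hx, EuclideanSpace.norm_sq_eq]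

/-- The entry `∂ᵢ fⱼ` of the gradient. -/
def gradEntry (f : H1) (i j : Fin 3) : Lp ℂ 2 (volume : Measure R3) := coord j (f.1.2 i)

/-- The entry of the symmetric gradient as an element of `L²`. -/
def strainEntry (f : H1) (i j : Fin 3) : Lp ℂ 2 (volume : Measure R3) :=
  (1 / 2 : ℂ) • (gradEntry f i j + gradEntry f j i)

theorem coeFn_strainEntry (f : H1) (i j : Fin 3) : strainEntry f i j =ᵐ[volume] strain f i j := by
  filter_upwards [Lp.coeFn_smul (1 / 2 : ℂ) (gradEntry f i j + gradEntry f j i),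
    Lp.coeFn_add (gradEntry f i j) (gradEntry f j i), coeFn_coord j (f.1.2 i),
    coeFn_coord i (f.1.2 j)] with x h1 h2 h3 h4
  rw [strainEntry, h1, Pi.smul_apply, h2, Pi.add_apply, gradEntry, gradEntry, h3, h4, strain,
    smul_eq_mul]
  ring

/-- This turns the mixed products in the squared strain into products of diagonal gradient entries,
which sum to the square of the divergence. -/
theorem inner_gradEntry_swap (f : H1) (i j : Fin 3) :
    inner ℂ (gradEntry f i j) (gradEntry f j i) =
      inner ℂ (gradEntry f j j) (gradEntry f i i) := by
  have h : ∀ k l, HasL2Deriv (EuclideanSpace.single k 1) (coord l f.1.1) (gradEntry f k l) :=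
    fun k l => (IsWeakPartial.hasL2Deriv (f.2 k)).coord l
  exact (h i j).inner_swap (h j j) (h i i) (h j i)

theorem norm_strainEntry_sq (f : H1) (i j : Fin 3) :
    ‖strainEntry f i j‖ ^ 2 = (‖gradEntry f i j‖ ^ 2 + ‖gradEntry f j i‖ ^ 2) / 4 +
      (inner ℂ (gradEntry f j j) (gradEntry f i i)).re / 2 := by
  rw [strainEntry, norm_smul, mul_pow, @norm_add_sq ℂ, inner_gradEntry_swap]
  norm_num
  ring

/-- Korn's inequality on the whole space. -/
theorem korn (f : H1) :
    ∑ i, ‖f.1.2 i‖ ^ 2 ≤ 2 * ∑ i, ∑ j, ‖strainEntry f i j‖ ^ 2 := by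
  -- The double sum is `‖div f‖²`; in fact `2 ‖strain‖² = ‖∇f‖² + ‖div f‖²`.
  have h1 : 0 ≤ ∑ i, ∑ j, (inner ℂ (gradEntry f j j) (gradEntry f i i)).re := by
    have h2 : 0 ≤ RCLike.re (inner ℂ (∑ j, gradEntry f j j) (∑ i, gradEntry f i i)) :=
      inner_self_nonneg
    rw [inner_sum] at h2
    simp only [sum_inner, map_sum] at h2
    exact h2
  have h3 : ∑ i, ∑ j, ‖gradEntry f j i‖ ^ 2 = ∑ i, ∑ j, ‖gradEntry f i j‖ ^ 2 :=
    Finset.sum_comm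
  have h4 : ∑ i, ‖f.1.2 i‖ ^ 2 = ∑ i, ∑ j, ‖gradEntry f i j‖ ^ 2 :=
    Finset.sum_congr rfl fun i _ => norm_sq_eq_sum_coord _
  simp only [norm_strainEntry_sq, Finset.sum_add_distrib, ← Finset.sum_div]
  rw [h3, h4]
  linarith

theorem sum_norm_strainEntry_sq_le (f : H1) :
    ∑ i, ∑ j, ‖strainEntry f i j‖ ^ 2 ≤ ∑ i, ‖f.1.2 i‖ ^ 2 := by
  have h3 : ∑ i, ∑ j, ‖gradEntry f j i‖ ^ 2 = ∑ i, ∑ j, ‖gradEntry f i j‖ ^ 2 :=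
    Finset.sum_comm
  have h4 : ∑ i, ‖f.1.2 i‖ ^ 2 = ∑ i, ∑ j, ‖gradEntry f i j‖ ^ 2 :=
    Finset.sum_congr rfl fun i _ => norm_sq_eq_sum_coord _
  have h5 : ∀ i j, ‖strainEntry f i j‖ ^ 2 ≤
      (‖gradEntry f i j‖ ^ 2 + ‖gradEntry f j i‖ ^ 2) / 2 := by
    intro i j
    rw [strainEntry, norm_smul, mul_pow]
    have := norm_add_le (gradEntry f i j) (gradEntry f j i)
    have h6 : ‖gradEntry f i j + gradEntry f j i‖ ^ 2 ≤
      (‖gradEntry f i j‖ + ‖gradEntry f j i‖) ^ 2 := by gcongr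
    norm_num
    nlinarith [sq_nonneg (‖gradEntry f i j‖ - ‖gradEntry f j i‖)]
  refine (Finset.sum_le_sum fun i _ => Finset.sum_le_sum fun j _ => h5 i j).trans ?_
  simp only [← Finset.sum_div, Finset.sum_add_distrib]
  rw [h3, h4]
  linarith

/-! ### Bounds for the elastic form -/

/-- Lowering the shear modulus by `d / 2` costs exactly `d` times the squared strain, so pointwise
nonnegativity for shifted moduli yields two-sided bounds on the density. -/
theorem elasticDensity_re_sub (l m d : ℝ) (e : Fin 3 → Fin 3 → ℂ) :
    ((l : ℂ) * (star (∑ j, e j j) * ∑ j, e j j) +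
      2 * ((m - d / 2 : ℝ) : ℂ) * ∑ i, ∑ j, star (e i j) * e i j).re =
    ((l : ℂ) * (star (∑ j, e j j) * ∑ j, e j j) +
      2 * (m : ℂ) * ∑ i, ∑ j, star (e i j) * e i j).re - d * ∑ i, ∑ j, ‖e i j‖ ^ 2 := by
  have h : (∑ i, ∑ j, star (e i j) * e i j) = ((∑ i, ∑ j, ‖e i j‖ ^ 2 : ℝ) : ℂ) := by
    push_cast
    refine Finset.sum_congr rfl fun i _ => Finset.sum_congr rfl fun j _ => ?_
    rw [Complex.star_def, Complex.conj_mul']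
  rw [h]
  generalize (∑ i, ∑ j, ‖e i j‖ ^ 2 : ℝ) = r
  have h2 : 2 * ((m - d / 2 : ℝ) : ℂ) * (r : ℂ) = 2 * (m : ℂ) * r - ((d * r : ℝ) : ℂ) := by
    push_cast
    ring
  rw [h2, ← add_sub_assoc, Complex.sub_re, Complex.ofReal_re]

theorem elasticDensity_eq (M : Medium) (f : H1) (x : R3) :
    elasticDensity M f f x = (M.lam x : ℂ) * (star (∑ j, strain f j j x) * ∑ j, strain f j j x) +
      2 * (M.mu x : ℂ) * ∑ i, ∑ j, star (strain f i j x) * strain f i j x := by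
  have hd : divergence f x = ∑ j, strain f j j x := by
    simp [divergence, strain]
  rw [elasticDensity, hd]

theorem elasticForm_re (M : Medium) (f : H1) :
    (elasticForm M f f).re = ∫ x, (elasticDensity M f f x).re :=
  (integral_re (𝕜 := ℂ) (integrable_elasticDensity M f f)).symm

theorem integrable_norm_strain_sq (f : H1) (i j : Fin 3) :
    Integrable (fun x => ‖strain f i j x‖ ^ 2) volume :=
  (memLp_strain f i j).integrable_norm_pow (by norm_num)

theorem integral_sum_norm_strain_sq (f : H1) :
    ∫ x, ∑ i, ∑ j, ‖strain f i j x‖ ^ 2 = ∑ i, ∑ j, ‖strainEntry f i j‖ ^ 2 := by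
  rw [integral_finsetSum _ fun i _ =>
    integrable_finsetSum _ fun j _ => integrable_norm_strain_sq f i j]
  refine Finset.sum_congr rfl fun i _ => ?_
  rw [integral_finsetSum _ fun j _ => integrable_norm_strain_sq f i j]
  refine Finset.sum_congr rfl fun j _ => ?_
  rw [L2_norm_sq]
  refine integral_congr_ae ?_
  filter_upwards [coeFn_strainEntry f i j] with x hx
  rw [hx]

theorem integrable_sum_norm_strain_sq (f : H1) :
    Integrable (fun x => ∑ i, ∑ j, ‖strain f i j x‖ ^ 2) volume :=
  integrable_finsetSum _ fun i _ => integrable_finsetSum _ fun j _ =>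
    integrable_norm_strain_sq f i j

theorem exists_elasticForm_coercive (M : Medium) :
    ∃ c : ℝ, 0 < c ∧ ∀ f : H1, c * ∑ i, ‖f.1.2 i‖ ^ 2 ≤ (elasticForm M f f).re := by
  obtain ⟨c, hc, hM⟩ := M.strongly_convex
  refine ⟨c / 2, by positivity, fun f => ?_⟩
  have h1 : c * ∑ i, ∑ j, ‖strainEntry f i j‖ ^ 2 ≤ (elasticForm M f f).re := by
    rw [← integral_sum_norm_strain_sq, ← integral_const_mul, elasticForm_re]
    refine integral_mono_ae ((integrable_sum_norm_strain_sq f).const_mul c)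
      (integrable_elasticDensity M f f).re ?_
    filter_upwards [hM] with x hx
    -- The shift by `c / 2` is admissible: `μ - c / 2 ≥ 0` and `3 λ + 2 (μ - c / 2) = 3 λ + 2 μ - c
    -- ≥ 0`.
    have h := elasticDensity_re_nonneg (M.lam x) (M.mu x - c / 2) (by linarith) (by linarith)
      (fun i j => strain f i j x)
    have h' := elasticDensity_re_sub (M.lam x) (M.mu x) c (fun i j => strain f i j x)
    rw [h', ← elasticDensity_eq] at h
    exact sub_nonneg.1 h
  have := mul_le_mul_of_nonneg_left (korn f) hc.le
  linarith

theorem exists_elasticForm_bound (M : Medium) :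
    ∃ C : ℝ, 0 ≤ C ∧ ∀ f : H1, (elasticForm M f f).re ≤ C * ∑ i, ‖f.1.2 i‖ ^ 2 := by
  obtain ⟨C, hM⟩ := M.bounded
  have hC : 0 ≤ C := by
    obtain ⟨x, hx⟩ := hM.exists
    exact (abs_nonneg _).trans hx.1
  refine ⟨5 * C, by positivity, fun f => ?_⟩
  refine le_trans ?_ (mul_le_mul_of_nonneg_left (sum_norm_strainEntry_sq_le f) (by positivity))
  rw [← integral_sum_norm_strain_sq, ← integral_const_mul, elasticForm_re]
  refine integral_mono_ae (integrable_elasticDensity M f f).re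
    ((integrable_sum_norm_strain_sq f).const_mul _) ?_
  filter_upwards [hM] with x hx
  have h1 := abs_le.1 hx.1
  have h2 := abs_le.1 hx.2
  -- The upper bound is nonnegativity for the negated moduli, raised by `5 C / 2`; the constant `5
  -- C` absorbs `-3 λ - 2 μ`.
  have h := elasticDensity_re_nonneg (-M.lam x) (-M.mu x - (-(5 * C)) / 2) (by linarith)
    (by linarith) (fun i j => strain f i j x)
  have h' := elasticDensity_re_sub (-M.lam x) (-M.mu x) (-(5 * C)) (fun i j => strain f i j x)
  rw [h'] at h
  have h3 := congrArg Complex.re (elasticDensity_eq M f x)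
  simp only [Complex.ofReal_neg, neg_mul, mul_neg, ← neg_add, Complex.neg_re] at h
  rw [← h3] at h
  linarith

/-! ### Abstract second order equations -/

section Abstract

open ContinuousLinearMap
open scoped InnerProduct

/-- A bounded continuous function that agrees with `1 / κ` for `|κ| ≥ ε`. -/
def invCutoff (ε κ : ℝ) : ℝ := κ / max (κ ^ 2) (ε ^ 2)

/-- A continuous function with values in `[0, 1]` that vanishes for `|κ| ≤ ε`. -/
def cutoff (ε κ : ℝ) : ℝ := max 0 (|κ| - ε) / max |κ| ε

theorem continuous_invCutoff {ε : ℝ} (hε : 0 < ε) : Continuous (invCutoff ε) := by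
  unfold invCutoff
  refine continuous_id.div ((continuous_id.pow 2).max continuous_const) fun x => ?_
  exact (lt_max_of_lt_right (by positivity)).ne'

theorem continuous_cutoff {ε : ℝ} (hε : 0 < ε) : Continuous (cutoff ε) := by
  unfold cutoff
  refine (continuous_const.max (continuous_abs.sub continuous_const)).div
    (continuous_abs.max continuous_const) fun x => ?_
  exact (lt_max_of_lt_right hε).ne'

theorem mul_cutoff_mul_invCutoff {ε : ℝ} (hε : 0 < ε) (κ : ℝ) :
    κ * (cutoff ε κ * invCutoff ε κ) = cutoff ε κ := by
  rcases le_total |κ| ε with h | h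
  · have : cutoff ε κ = 0 := by rw [cutoff, max_eq_left (by linarith), zero_div]
    rw [this, zero_mul, mul_zero]
  · have h0 : κ ≠ 0 := by
      rintro rfl
      rw [abs_zero] at h
      linarith
    have h1 : ε ^ 2 ≤ κ ^ 2 := by
      rw [← sq_abs κ]
      gcongr
    rw [invCutoff, max_eq_left h1]
    field_simp

theorem abs_one_sub_cutoff_le {ε : ℝ} (hε : 0 < ε) (κ : ℝ) : |1 - cutoff ε κ| ≤ 1 := by
  have h1 : 0 ≤ cutoff ε κ := by unfold cutoff; positivity
  have h2 : cutoff ε κ ≤ 1 := by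
    unfold cutoff
    refine div_le_one_of_le₀ (max_le (by positivity) ?_) (by positivity)
    exact (by linarith : |κ| - ε ≤ |κ|).trans (le_max_left _ _)
  rw [abs_le]
  constructor <;> linarith

/-- For `|κ| ≥ ε` the cutoff is `1 - ε / |κ|`, so equality holds there. One factor of `κ` thus makes
the error uniformly small, although `1 - cutoff ε κ` itself is not. -/
theorem abs_mul_one_sub_cutoff_le {ε : ℝ} (hε : 0 < ε) (κ : ℝ) :
    |κ * (1 - cutoff ε κ)| ≤ ε := by
  rw [abs_mul]
  rcases le_total |κ| ε with h | h
  · calc |κ| * |1 - cutoff ε κ| ≤ ε * 1 := by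
          gcongr
          exact abs_one_sub_cutoff_le hε κ
      _ = ε := mul_one ε
  · have h0 : 0 < |κ| := hε.trans_le h
    have : 1 - cutoff ε κ = ε / |κ| := by
      rw [cutoff, max_eq_right (by linarith), max_eq_left h]
      field_simp
      ring
    have h2 : 0 ≤ ε / |κ| := div_nonneg hε.le h0.le
    rw [this, abs_of_nonneg h2, mul_div_cancel₀ _ h0.ne']

theorem exists_bounded_system {X : Type*} [NormedAddCommGroup X] [NormedSpace ℝ X]
    [CompleteSpace X] (B : X →L[ℝ] X) (z y : X) :
    ∃ p q : ℝ → X, p 0 = z ∧ q 0 = y ∧ (∀ t, HasDerivAt p (q t) t) ∧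
      ∀ t, HasDerivAt q (-(B (p t))) t := by
  let N : X × X →L[ℝ] X × X := (ContinuousLinearMap.snd ℝ X X).prod
    (-(B.comp (ContinuousLinearMap.fst ℝ X X)))
  have hP : ∀ t : ℝ, HasDerivAt (fun s : ℝ => NormedSpace.exp (s • N) (z, y))
      (N (NormedSpace.exp (t • N) (z, y))) t := fun t => by
    simpa using (hasDerivAt_exp_smul_const' (𝕂 := ℝ) N t).clm_apply
      (hasDerivAt_const t ((z, y) : X × X))
  refine ⟨fun t => (NormedSpace.exp (t • N) (z, y)).1, fun t => (NormedSpace.exp (t • N) (z, y)).2,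
    by simp, by simp, fun t => ?_, fun t => ?_⟩
  · exact (ContinuousLinearMap.fst ℝ X X).hasFDerivAt.comp_hasDerivAt t (hP t)
  · exact (ContinuousLinearMap.snd ℝ X X).hasFDerivAt.comp_hasDerivAt t (hP t)

/-! ### Abstract waves and spectral cutoff -/

variable {V H : Type*} [NormedAddCommGroup V] [InnerProductSpace ℂ V] [CompleteSpace V]
  [NormedAddCommGroup H] [InnerProductSpace ℂ H] [CompleteSpace H]

/-- A solution of `J† (d²/dt²) J u = -(1 - J† J) u`, together with its velocity `v`. -/
structure IsAbstractWave (J : V →L[ℂ] H) (u : ℝ → V) (v : ℝ → H) : Prop where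
  continuous_left : Continuous u
  continuous_right : Continuous v
  velocity : ∀ t, HasDerivAt (fun s => J (u s)) (v t) t
  equation : ∀ w t, HasDerivAt (fun s => inner ℂ (J w) (v s))
    (-(inner ℂ w (u t) - inner ℂ (J w) (J (u t)))) t

theorem isSelfAdjoint_comp_adjoint (J : V →L[ℂ] H) : IsSelfAdjoint (J ∘L J†) := by
  rw [ContinuousLinearMap.isSelfAdjoint_iff', adjoint_comp, adjoint_adjoint]

/-- With `K = J J†`, the generator is formally `K⁻¹ - 1`: if `u = J† z`, then `⟪w, u⟫ = ⟪J w, z⟫`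
and `J u = K z`. Where the cutoff is nonzero, `K⁻¹` equals the bounded operator `Mc`. So `p'' = -(Mc
- 1) p` is solved by an exponential, and `u = J† Fc Mc p`, `v = Fc p'` is a wave because `J u = Fc
p`. -/
theorem exists_abstractWave_cutoff (J : V →L[ℂ] H) {ε : ℝ} (hε : 0 < ε) (x y : H) :
    ∃ u v, IsAbstractWave J u v ∧ u 0 = (J†) (cfc (cutoff ε) (J ∘L J†) x) ∧
      v 0 = cfc (cutoff ε) (J ∘L J†) y := by
  set K : H →L[ℂ] H := J ∘L J† with hK
  have hKs : IsSelfAdjoint K := isSelfAdjoint_comp_adjoint J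
  set Fc : H →L[ℂ] H := cfc (cutoff ε) K with hFc
  set Mc : H →L[ℂ] H := cfc (invCutoff ε) K with hMc
  have hcF := (continuous_cutoff hε).continuousOn (s := spectrum ℝ K)
  have hcM := (continuous_invCutoff hε).continuousOn (s := spectrum ℝ K)
  have e0 : cfc (fun κ : ℝ => cutoff ε κ * invCutoff ε κ) K = Fc * Mc := cfc_mul _ _ K hcF hcM
  have e1 : K * (Fc * Mc) = Fc := by
    have h1 : cfc (fun κ : ℝ => κ * (cutoff ε κ * invCutoff ε κ)) K = K * (Fc * Mc) := by
      rw [cfc_mul (fun κ => κ) (fun κ => cutoff ε κ * invCutoff ε κ) K continuousOn_id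
        (hcF.mul hcM), e0, cfc_id' ℝ K]
    rw [← h1, hFc]
    exact cfc_congr fun κ _ => mul_cutoff_mul_invCutoff hε κ
  have e2 : Fc * Mc * K = Fc := by
    have h1 : cfc (fun κ : ℝ => (cutoff ε κ * invCutoff ε κ) * κ) K = Fc * Mc * K := by
      rw [cfc_mul (fun κ => cutoff ε κ * invCutoff ε κ) (fun κ => κ) K (hcF.mul hcM)
        continuousOn_id, e0, cfc_id' ℝ K]
    rw [← h1, hFc]
    refine cfc_congr fun κ _ => ?_
    rw [mul_comm]
    exact mul_cutoff_mul_invCutoff hε κ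
  -- The initial value is `K x` because `Fc Mc K = Fc` then gives `u 0 = J† Fc x`.
  obtain ⟨p, q, hp0, hq0, hp, hq⟩ := exists_bounded_system ((Mc - 1).restrictScalars ℝ) (K x) y
  have hpc : Continuous p := continuous_iff_continuousAt.2 fun t => (hp t).continuousAt
  have hqc : Continuous q := continuous_iff_continuousAt.2 fun t => (hq t).continuousAt
  have e3 : ∀ z, J ((J†) ((Fc * Mc) z)) = Fc z := fun z => by
    conv_rhs => rw [← e1]
    rfl
  refine ⟨fun t => (J†) ((Fc * Mc) (p t)), fun t => Fc (q t), ⟨?_, ?_, ?_, ?_⟩, ?_, ?_⟩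
  · exact (J†).continuous.comp ((Fc * Mc).continuous.comp hpc)
  · exact Fc.continuous.comp hqc
  · intro t
    simp only [e3]
    exact (Fc.restrictScalars ℝ).hasFDerivAt.comp_hasDerivAt t (hp t)
  · intro w t
    have h1 : HasDerivAt (fun s => Fc (q s)) (Fc (-((Mc - 1) (p t)))) t :=
      (Fc.restrictScalars ℝ).hasFDerivAt.comp_hasDerivAt t (hq t)
    refine ((hasDerivAt_const t (J w)).inner ℂ h1).congr_deriv ?_
    rw [e3, adjoint_inner_right, inner_zero_left, add_zero, ← inner_sub_right, ← inner_neg_right]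
    simp
  · simp only [hp0]
    conv_rhs => rw [← e2]
    rfl
  · simp only [hq0]

theorem denseRange_adjoint {J : V →L[ℂ] H} (hJ : Function.Injective J) : DenseRange (J†) := by
  have h : (LinearMap.range (J†).toLinearMap)ᗮ = ⊥ := by
    have := ContinuousLinearMap.orthogonal_range (J†)
    rw [adjoint_adjoint] at this
    rw [this]
    exact LinearMap.ker_eq_bot.2 hJ
  have h2 := (Submodule.topologicalClosure_eq_top_iff).2 h
  exact (Submodule.dense_iff_topologicalClosure_eq_top).2 h2

/-- Data `(J† x, K y)` are dense, and each component carries a factor that damps the low end of the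
spectrum of `K`, where the cutoff acts. -/
theorem exists_abstractWave_near {J : V →L[ℂ] H} (hJ : Function.Injective J)
    (hd : DenseRange J) (a : V) (b : H) {δ : ℝ} (hδ : 0 < δ) :
    ∃ u v, IsAbstractWave J u v ∧ ‖u 0 - a‖ < δ ∧ ‖v 0 - b‖ < δ := by
  have hδ2 : 0 < δ / 2 := by positivity
  have hadj := denseRange_adjoint hJ
  obtain ⟨x, hx⟩ := hadj.exists_dist_lt a hδ2
  have hKd : DenseRange (J ∘L J†) := hd.comp hadj J.continuous
  obtain ⟨y, hy⟩ := hKd.exists_dist_lt b hδ2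
  rw [dist_eq_norm'] at hx hy
  set K : H →L[ℂ] H := J ∘L J† with hK
  have hKs : IsSelfAdjoint K := isSelfAdjoint_comp_adjoint J
  -- The errors are `‖J† (1 - Fc) x‖² = ⟪K (1 - Fc) x, (1 - Fc) x⟫ ≤ ε ‖x‖²` and `‖(1 - Fc) K y‖ ≤ ε
  -- ‖y‖`. The added ones avoid division by zero.
  set ε : ℝ := min ((δ / 2) ^ 2 / (‖x‖ ^ 2 + 1)) ((δ / 2) / (‖y‖ + 1)) with hεdef
  have hε : 0 < ε := lt_min (by positivity) (by positivity)
  have hε1 : ε * ‖x‖ ^ 2 < (δ / 2) ^ 2 := by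
    calc ε * ‖x‖ ^ 2 < ε * (‖x‖ ^ 2 + 1) := by gcongr; linarith
      _ ≤ (δ / 2) ^ 2 / (‖x‖ ^ 2 + 1) * (‖x‖ ^ 2 + 1) := by gcongr; exact min_le_left _ _
      _ = (δ / 2) ^ 2 := by field_simp
  have hε2 : ε * ‖y‖ < δ / 2 := by
    calc ε * ‖y‖ < ε * (‖y‖ + 1) := by gcongr; linarith
      _ ≤ (δ / 2) / (‖y‖ + 1) * (‖y‖ + 1) := by gcongr; exact min_le_right _ _
      _ = δ / 2 := by field_simp
  set Fc : H →L[ℂ] H := cfc (cutoff ε) K with hFc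
  have hcF := (continuous_cutoff hε).continuousOn (s := spectrum ℝ K)
  have e1 : cfc (fun κ : ℝ => 1 - cutoff ε κ) K = 1 - Fc := by
    rw [cfc_sub _ _ K continuousOn_const hcF, cfc_const_one ℝ K]
  have n1 : ‖(1 : H →L[ℂ] H) - Fc‖ ≤ 1 := by
    rw [← e1]
    exact norm_cfc_le zero_le_one fun κ _ => abs_one_sub_cutoff_le hε κ
  have n2 : ‖K * (1 - Fc)‖ ≤ ε := by
    rw [← e1]
    nth_rw 1 [← cfc_id' ℝ K]
    rw [← cfc_mul (fun κ => κ) (fun κ => 1 - cutoff ε κ) K continuousOn_id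
      (continuousOn_const.sub hcF)]
    exact norm_cfc_le hε.le fun κ _ => abs_mul_one_sub_cutoff_le hε κ
  have n3 : ‖(1 - Fc) * K‖ ≤ ε := by
    rw [← e1]
    nth_rw 2 [← cfc_id' ℝ K]
    rw [← cfc_mul (fun κ => 1 - cutoff ε κ) (fun κ => κ) K (continuousOn_const.sub hcF)
      continuousOn_id]
    refine norm_cfc_le hε.le fun κ _ => ?_
    rw [mul_comm]
    exact abs_mul_one_sub_cutoff_le hε κ
  obtain ⟨u, v, huv, hu0, hv0⟩ := exists_abstractWave_cutoff J hε x (K y)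
  refine ⟨u, v, huv, ?_, ?_⟩
  · have h1 : ‖(J†) ((1 - Fc) x)‖ < δ / 2 := by
      refine lt_of_pow_lt_pow_left₀ 2 hδ2.le (lt_of_le_of_lt ?_ hε1)
      have h2 : ‖(J†) ((1 - Fc) x)‖ ^ 2 =
          RCLike.re (inner ℂ ((K * (1 - Fc)) x) ((1 - Fc) x)) := by
        rw [← inner_self_eq_norm_sq (𝕜 := ℂ), adjoint_inner_right]
        rfl
      rw [h2]
      refine (RCLike.re_le_norm _).trans ((norm_inner_le_norm _ _).trans ?_)
      calc ‖(K * (1 - Fc)) x‖ * ‖(1 - Fc) x‖ ≤ (ε * ‖x‖) * (1 * ‖x‖) := by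
            gcongr
            · exact (K * (1 - Fc)).le_of_opNorm_le n2 x
            · exact (1 - Fc).le_of_opNorm_le n1 x
        _ = ε * ‖x‖ ^ 2 := by ring
    have h3 : u 0 - a = ((J†) x - a) - (J†) ((1 - Fc) x) := by
      change u 0 = (J†) (Fc x) at hu0
      rw [hu0]
      simp
    rw [h3]
    exact (norm_sub_le _ _).trans_lt (by linarith)
  · have h1 : ‖((1 - Fc) * K) y‖ < δ / 2 :=
      (((1 - Fc) * K).le_of_opNorm_le n3 y).trans_lt hε2
    have h3 : v 0 - b = (K y - b) - ((1 - Fc) * K) y := by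
      change v 0 = Fc (K y) at hv0
      rw [hv0]
      simp
    rw [h3]
    exact (norm_sub_le _ _).trans_lt (by linarith)

end Abstract

/-! ### The Sobolev space as a Hilbert space -/

theorem IsTest.partialDeriv {φ : R3 → ℝ} (hφ : IsTest φ) (j : Fin 3) :
    IsTest (partialDeriv j φ) := by
  refine ⟨?_, hφ.2.fderiv_apply (𝕜 := ℝ) _⟩
  exact (hφ.1.fderiv_right (m := ∞) (by simp)).clm_apply contDiff_const

instance completeSpace_H1 : CompleteSpace H1 := by
  have h : (H1 : Set (L2 × (Fin 3 → L2))) = ⋂ j, ⋂ φ, ⋂ hφ : IsTest φ,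
      {p | testPairing (partialDeriv j φ) (hφ.partialDeriv j) p.1 =
        -testPairing φ hφ (p.2 j)} := by
    ext p
    simp only [Set.mem_iInter, Set.mem_ofPred_eq]
    exact Iff.rfl
  have hc : IsClosed (H1 : Set (L2 × (Fin 3 → L2))) := by
    rw [h]
    refine isClosed_iInter fun j => isClosed_iInter fun φ => isClosed_iInter fun hφ => ?_
    refine isClosed_eq ((testPairing _ _).continuous.comp continuous_fst) ?_
    exact ((testPairing φ hφ).continuous.comp ((continuous_apply j).comp continuous_snd)).neg
  exact hc.completeSpace_coe

theorem H1_norm_sq_le (f : H1) : ‖f‖ ^ 2 ≤ ‖f.1.1‖ ^ 2 + ∑ i, ‖f.1.2 i‖ ^ 2 := by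
  have hs : 0 ≤ ∑ i, ‖f.1.2 i‖ ^ 2 := by positivity
  have h0 : 0 ≤ ‖f.1.1‖ ^ 2 + ∑ i, ‖f.1.2 i‖ ^ 2 := by positivity
  refine (Real.le_sqrt (norm_nonneg _) h0).1 ?_
  change ‖f.1‖ ≤ _
  rw [Prod.norm_def]
  refine max_le (Real.le_sqrt_of_sq_le (by linarith)) ?_
  refine (pi_norm_le_iff_of_nonneg (Real.sqrt_nonneg _)).2 fun i => Real.le_sqrt_of_sq_le ?_
  have := Finset.single_le_sum (f := fun i => ‖f.1.2 i‖ ^ 2) (fun i _ => by positivity)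
    (Finset.mem_univ i)
  have h2 : 0 ≤ ‖f.1.1‖ ^ 2 := by positivity
  linarith

theorem norm_fst_le_H1 (f : H1) : ‖f.1.1‖ ≤ ‖f‖ := norm_fst_le f.1

theorem norm_grad_le_H1 (f : H1) (i : Fin 3) : ‖f.1.2 i‖ ≤ ‖f‖ :=
  (norm_le_pi_norm f.1.2 i).trans (norm_snd_le f.1)

theorem sum_norm_grad_sq_le_H1 (f : H1) : ∑ i, ‖f.1.2 i‖ ^ 2 ≤ 3 * ‖f‖ ^ 2 := by
  have : ∀ i ∈ Finset.univ, ‖f.1.2 i‖ ^ 2 ≤ ‖f‖ ^ 2 := fun i _ => by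
    gcongr
    exact norm_grad_le_H1 f i
  simpa using Finset.sum_le_sum this

theorem H1_ext {f g : H1} (h : f.1.1 = g.1.1) : f = g := by
  refine Subtype.ext (Prod.ext h (funext fun j => ?_))
  have h1 := IsWeakPartial.hasL2Deriv (f.2 j)
  have h2 := IsWeakPartial.hasL2Deriv (g.2 j)
  rw [h] at h1
  exact h1.unique h2

/-- The Sobolev space with the inner product given by the elastic form plus that of `L²`. -/
def FormSpace (_M : Medium) : Type := H1

instance (M : Medium) : AddCommGroup (FormSpace M) := inferInstanceAs (AddCommGroup H1)

instance (M : Medium) : Module ℂ (FormSpace M) := inferInstanceAs (Module ℂ H1)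

instance formCore (M : Medium) : InnerProductSpace.Core ℂ (FormSpace M) where
  inner f g := elasticForm M f g + inner ℂ f.1.1 g.1.1
  conj_inner_symm f g := by
    have := elasticForm_conj M f g
    simp only [map_add, inner_conj_symm]
    rw [← this]
    rfl
  re_inner_nonneg f := by
    have h1 := elasticForm_re_nonneg M f
    have h2 : 0 ≤ RCLike.re (inner ℂ f.1.1 f.1.1) := inner_self_nonneg
    simp only [map_add]
    exact add_nonneg h1 h2
  add_left f g h := by
    have h2 : inner ℂ (f.1.1 + g.1.1) h.1.1 = inner ℂ f.1.1 h.1.1 + inner ℂ g.1.1 h.1.1 :=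
      inner_add_left _ _ _
    exact (congrArg₂ (· + ·) (elasticForm_add_left M f g h) h2).trans (add_add_add_comm _ _ _ _)
  smul_left f g c := by
    have h2 : inner ℂ (c • f.1.1) g.1.1 = star c * inner ℂ f.1.1 g.1.1 := inner_smul_left _ _ _
    exact (congrArg₂ (· + ·) (elasticForm_smul_left M c f g) h2).trans (mul_add _ _ _).symm
  definite f hf := by
    have h1 := elasticForm_re_nonneg M f
    have h2 : RCLike.re (inner ℂ f.1.1 f.1.1) = ‖f.1.1‖ ^ 2 := inner_self_eq_norm_sq f.1.1
    have h3 : (elasticForm M f f).re + RCLike.re (inner ℂ f.1.1 f.1.1) = 0 :=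
      congrArg Complex.re hf
    have h4 : ‖f.1.1‖ = 0 := by
      rw [h2] at h3
      have : ‖f.1.1‖ ^ 2 = 0 := le_antisymm (by linarith) (by positivity)
      exact pow_eq_zero_iff (by norm_num) |>.1 this
    exact H1_ext (f := f) (g := (0 : H1)) (norm_eq_zero.1 h4)

instance (M : Medium) : NormedAddCommGroup (FormSpace M) :=
  InnerProductSpace.Core.toNormedAddCommGroup (𝕜 := ℂ)

instance (M : Medium) : InnerProductSpace ℂ (FormSpace M) :=
  InnerProductSpace.ofCore (formCore M).toCore

/-- The identity from `H¹` to the form space. -/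
def toForm (M : Medium) : H1 ≃ₗ[ℂ] FormSpace M := LinearEquiv.refl ℂ H1

theorem inner_toForm (M : Medium) (f g : H1) :
    inner ℂ (toForm M f) (toForm M g) = elasticForm M f g + inner ℂ f.1.1 g.1.1 := rfl

theorem norm_toForm_sq (M : Medium) (f : H1) :
    ‖toForm M f‖ ^ 2 = (elasticForm M f f).re + ‖f.1.1‖ ^ 2 := by
  have h1 : RCLike.re (inner ℂ (toForm M f) (toForm M f)) = ‖toForm M f‖ ^ 2 :=
    inner_self_eq_norm_sq _
  have h2 : RCLike.re (inner ℂ f.1.1 f.1.1) = ‖f.1.1‖ ^ 2 := inner_self_eq_norm_sq f.1.1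
  rw [← h1, ← h2, inner_toForm]
  rfl

theorem exists_norm_toForm_le (M : Medium) : ∃ C : ℝ, ∀ f : H1, ‖toForm M f‖ ≤ C * ‖f‖ := by
  obtain ⟨C, hC, h⟩ := exists_elasticForm_bound M
  refine ⟨√(C * 3 + 1), fun f => ?_⟩
  refine le_of_sq_le_sq ?_ (by positivity)
  rw [mul_pow, Real.sq_sqrt (by positivity), norm_toForm_sq]
  have h1 := h f
  have h2 := mul_le_mul_of_nonneg_left (sum_norm_grad_sq_le_H1 f) hC
  have h3 : ‖f.1.1‖ ^ 2 ≤ ‖f‖ ^ 2 := by gcongr; exact norm_fst_le_H1 f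
  linarith

theorem exists_le_norm_toForm (M : Medium) : ∃ C : ℝ, ∀ f : H1, ‖f‖ ≤ C * ‖toForm M f‖ := by
  obtain ⟨c, hc, h⟩ := exists_elasticForm_coercive M
  refine ⟨√(1 / c + 1), fun f => ?_⟩
  refine le_of_sq_le_sq ?_ (by positivity)
  rw [mul_pow, Real.sq_sqrt (by positivity)]
  have h1 : ∑ i, ‖f.1.2 i‖ ^ 2 ≤ 1 / c * ‖toForm M f‖ ^ 2 := by
    rw [one_div, ← div_eq_inv_mul, le_div_iff₀ hc, norm_toForm_sq]
    have := h f
    have h3 : 0 ≤ ‖f.1.1‖ ^ 2 := by positivity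
    linarith
  have h2 : ‖f.1.1‖ ^ 2 ≤ ‖toForm M f‖ ^ 2 := by
    rw [norm_toForm_sq]
    have := elasticForm_re_nonneg M f
    linarith
  have := H1_norm_sq_le f
  linarith

/-- The Sobolev space and the form space have equivalent norms. -/
def formEquiv (M : Medium) : H1 ≃L[ℂ] FormSpace M :=
  (toForm M).toContinuousLinearEquivOfBounds (exists_norm_toForm_le M).choose
    (exists_le_norm_toForm M).choose (exists_norm_toForm_le M).choose_spec
    (fun f => (exists_le_norm_toForm M).choose_spec ((toForm M).symm f))

theorem formEquiv_apply (M : Medium) (f : H1) : formEquiv M f = toForm M f := rfl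

instance (M : Medium) : CompleteSpace (FormSpace M) :=
  (completeSpace_congr (e := (formEquiv M).toEquiv) (formEquiv M).isUniformEmbedding).1
    completeSpace_H1

/-- The displacement of a Sobolev field. -/
def displacement : H1 →L[ℂ] L2 := (ContinuousLinearMap.fst ℂ L2 (Fin 3 → L2)).comp H1.subtypeL

theorem exists_H1_of_contDiff {φ : R3 → C3} (hφ : ContDiff ℝ ∞ φ) (hc : HasCompactSupport φ) :
    ∃ f : H1, f.1.1 =ᵐ[volume] φ ∧
      ∀ j, f.1.2 j =ᵐ[volume] fun x => fderiv ℝ φ x (EuclideanSpace.single j 1) := by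
  have h1 : MemLp φ 2 volume := hφ.continuous.memLp_of_hasCompactSupport hc
  have hcd : ∀ j : Fin 3, Continuous fun x => fderiv ℝ φ x (EuclideanSpace.single j 1) :=
    fun j => (hφ.continuous_fderiv (by simp)).clm_apply continuous_const
  have hsd : ∀ j : Fin 3, HasCompactSupport fun x => fderiv ℝ φ x (EuclideanSpace.single j 1) :=
    fun j => hc.fderiv_apply (𝕜 := ℝ) _
  have h2 : ∀ j : Fin 3, MemLp (fun x => fderiv ℝ φ x (EuclideanSpace.single j 1)) 2 volume :=
    fun j => (hcd j).memLp_of_hasCompactSupport (hsd j)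
  refine ⟨⟨(h1.toLp, fun j => (h2 j).toLp), fun j ψ hψ => ?_⟩, h1.coeFn_toLp,
    fun j => (h2 j).coeFn_toLp⟩
  have e1 : ∫ x, ElasticScattering.partialDeriv j ψ x • (h1.toLp : L2) x =
      ∫ x, ElasticScattering.partialDeriv j ψ x • φ x := by
    refine integral_congr_ae ?_
    filter_upwards [h1.coeFn_toLp] with x hx
    rw [hx]
  have e2 : ∫ x, ψ x • ((h2 j).toLp : L2) x =
      ∫ x, ψ x • fderiv ℝ φ x (EuclideanSpace.single j 1) := by
    refine integral_congr_ae ?_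
    filter_upwards [(h2 j).coeFn_toLp] with x hx
    rw [hx]
  change ∫ x, ElasticScattering.partialDeriv j ψ x • (h1.toLp : L2) x =
    -∫ x, ψ x • ((h2 j).toLp : L2) x
  rw [e1, e2, integral_smul_fderiv_eq_neg_fderiv_smul_of_integrable, neg_neg]
  · rfl
  · exact ((hψ.partialDeriv j).1.continuous.smul hφ.continuous).integrable_of_hasCompactSupport
      hc.smul_left
  · exact (hψ.1.continuous.smul (hcd j)).integrable_of_hasCompactSupport (hsd j).smul_left
  · exact (hψ.1.continuous.smul hφ.continuous).integrable_of_hasCompactSupport hc.smul_left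
  · exact fun x _ => (hψ.1.differentiable (by simp)) x
  · exact fun x _ => (hφ.differentiable (by simp)) x

theorem denseRange_displacement : DenseRange displacement := by
  refine (Lp.dense_hasCompactSupport_contDiff (F := C3) (E := R3) (μ := volume) (p := 2)
    (by norm_num)).mono ?_
  rintro f ⟨φ, hfφ, hc, hφ⟩
  obtain ⟨g, hg, -⟩ := exists_H1_of_contDiff hφ hc
  exact ⟨g, Lp.ext (hg.trans hfφ.symm)⟩

/-! ### Existence of waves -/

open Filter Topology

theorem cauchyData_norm_sq (M : Medium) (h : CauchyData M) :
    ‖h‖ ^ 2 = ‖h.2‖ ^ 2 + (elasticForm M h.1 h.1).re := by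
  have h1 : RCLike.re (inner ℂ h h) = ‖h‖ ^ 2 := inner_self_eq_norm_sq h
  have h2 : RCLike.re (inner ℂ h.2 h.2) = ‖h.2‖ ^ 2 := inner_self_eq_norm_sq h.2
  rw [← h1, ← h2]
  rfl

theorem norm_velocity_le (M : Medium) (h : CauchyData M) : ‖h.2‖ ≤ ‖h‖ := by
  refine le_of_sq_le_sq ?_ (norm_nonneg _)
  rw [cauchyData_norm_sq]
  have := elasticForm_re_nonneg M h.1
  linarith

theorem exists_norm_grad_le (M : Medium) :
    ∃ C : ℝ, 0 ≤ C ∧ ∀ (h : CauchyData M) (i : Fin 3), ‖h.1.1.2 i‖ ≤ C * ‖h‖ := by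
  obtain ⟨c, hc, hM⟩ := exists_elasticForm_coercive M
  refine ⟨√(1 / c), by positivity, fun h i => ?_⟩
  refine le_of_sq_le_sq ?_ (by positivity)
  rw [mul_pow, Real.sq_sqrt (by positivity), cauchyData_norm_sq, one_div, ← div_eq_inv_mul,
    le_div_iff₀ hc]
  have h1 := hM h.1
  have h2 := Finset.single_le_sum (f := fun i => ‖h.1.1.2 i‖ ^ 2) (fun i _ => by positivity)
    (Finset.mem_univ i)
  have h3 : 0 ≤ ‖h.2‖ ^ 2 := by positivity
  have h4 := mul_le_mul_of_nonneg_left h2 hc.le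
  linarith

theorem exists_cauchyData_norm_le (M : Medium) :
    ∃ C : ℝ, 0 ≤ C ∧ ∀ h : H1 × L2, ‖(show CauchyData M from h)‖ ≤ C * ‖h‖ := by
  obtain ⟨C, hC, hM⟩ := exists_elasticForm_bound M
  refine ⟨√(1 + C * 3), by positivity, fun h => ?_⟩
  refine le_of_sq_le_sq ?_ (by positivity)
  rw [mul_pow, Real.sq_sqrt (by positivity), cauchyData_norm_sq]
  have h1 : ‖h.2‖ ^ 2 ≤ ‖h‖ ^ 2 := by gcongr; exact norm_snd_le h
  have h2 : ‖h.1‖ ^ 2 ≤ ‖h‖ ^ 2 := by gcongr; exact norm_fst_le h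
  have h3 := hM h.1
  have h4 := mul_le_mul_of_nonneg_left
    ((sum_norm_grad_sq_le_H1 h.1).trans (mul_le_mul_of_nonneg_left h2 (by norm_num : (0:ℝ) ≤ 3))) hC
  linarith

/-- The energy controls velocity and gradient but not the `L²` norm of the displacement. That norm
is bounded by integrating the velocity, whence the linear growth. -/
theorem exists_wave_bound (M : Medium) : ∃ C : ℝ, 0 ≤ C ∧ ∀ U : ℝ → H1 × L2, IsWave M U →
    ∀ t, ‖U t‖ ≤ C * (1 + |t|) * ‖U 0‖ := by
  obtain ⟨C₁, hC₁, h₁⟩ := exists_norm_grad_le M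
  obtain ⟨C₂, hC₂, h₂⟩ := exists_cauchyData_norm_le M
  refine ⟨1 + C₂ + C₁ * C₂, by positivity, fun U hU t => ?_⟩
  have he : ∀ s, ‖(show CauchyData M from U s)‖ ≤ C₂ * ‖U 0‖ := fun s => by
    rw [hU.norm_eq s]
    exact h₂ _
  have hv : ∀ s, ‖(U s).2‖ ≤ C₂ * ‖U 0‖ := fun s => (norm_velocity_le M (U s)).trans (he s)
  have hg : ∀ s i, ‖(U s).1.1.2 i‖ ≤ C₁ * (C₂ * ‖U 0‖) := fun s i =>
    (h₁ (U s) i).trans (by gcongr; exact he s)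
  have hu : ‖(U t).1.1.1‖ ≤ ‖U 0‖ + C₂ * ‖U 0‖ * |t| := by
    have h3 := convex_univ.norm_image_sub_le_of_norm_hasDerivWithin_le (𝕜 := ℝ)
      (f := fun s => (U s).1.1.1) (fun s _ => (hU.velocity s).hasDerivWithinAt)
      (fun s _ => hv s) (Set.mem_univ 0) (Set.mem_univ t)
    rw [sub_zero, Real.norm_eq_abs] at h3
    have h4 : ‖(U 0).1.1.1‖ ≤ ‖U 0‖ := (norm_fst_le_H1 _).trans (norm_fst_le (U 0))
    have h5 := norm_le_norm_add_norm_sub' (U t).1.1.1 (U 0).1.1.1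
    linarith
  have hN := norm_nonneg (U 0)
  have ht := abs_nonneg t
  have p1 := mul_nonneg hC₂ hN
  have p2 := mul_nonneg hC₁ p1
  have p3 := mul_nonneg hN ht
  have p4 := mul_nonneg p1 ht
  have p5 := mul_nonneg p2 ht
  have e : (1 + C₂ + C₁ * C₂) * (1 + |t|) * ‖U 0‖ = ‖U 0‖ + C₂ * ‖U 0‖ + C₁ * (C₂ * ‖U 0‖) +
      ‖U 0‖ * |t| + C₂ * ‖U 0‖ * |t| + C₁ * (C₂ * ‖U 0‖) * |t| := by ring
  rw [e]
  refine max_le (max_le ?_ ?_) ?_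
  · change ‖(U t).1.1.1‖ ≤ _
    linarith
  · change ‖(U t).1.1.2‖ ≤ _
    refine (pi_norm_le_iff_of_nonneg (by positivity)).2 fun i => ?_
    have := hg t i
    linarith
  · have := hv t
    change ‖(U t).2‖ ≤ _
    linarith

/-- The displacement as an operator on the form space. -/
def formDisplacement (M : Medium) : FormSpace M →L[ℂ] L2 :=
  displacement.comp ((formEquiv M).symm : FormSpace M →L[ℂ] H1)

theorem formDisplacement_injective (M : Medium) : Function.Injective (formDisplacement M) :=
  fun _ _ h => (formEquiv M).symm.injective (H1_ext h)

theorem denseRange_formDisplacement (M : Medium) : DenseRange (formDisplacement M) :=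
  denseRange_displacement.comp (formEquiv M).symm.surjective.denseRange displacement.continuous

theorem inner_formEquiv (M : Medium) (w f : H1) :
    inner ℂ (formEquiv M w) (formEquiv M f) - inner ℂ w.1.1 f.1.1 = elasticForm M w f := by
  rw [formEquiv_apply, formEquiv_apply, inner_toForm, add_sub_cancel_right]

theorem inner_formEquiv_sub (M : Medium) (w : H1) (g : FormSpace M) :
    inner ℂ (formEquiv M w) g -
      inner ℂ (formDisplacement M (formEquiv M w)) (formDisplacement M g) =
      elasticForm M w ((formEquiv M).symm g) := by
  have h := inner_formEquiv M w ((formEquiv M).symm g)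
  rw [ContinuousLinearEquiv.apply_symm_apply] at h
  exact h

theorem IsAbstractWave.isWave {M : Medium} {u : ℝ → FormSpace M} {v : ℝ → L2}
    (h : IsAbstractWave (formDisplacement M) u v) :
    IsWave M fun t => ((formEquiv M).symm (u t), v t) where
  continuous := ((formEquiv M).symm.continuous.comp h.continuous_left).prodMk h.continuous_right
  velocity := h.velocity
  equation w t := (h.equation (formEquiv M w) t).congr_deriv
    (congrArg Neg.neg (inner_formEquiv_sub M w (u t)))

theorem norm_toForm_symm_sub_le {M : Medium} {C D : ℝ} (hle : C ≤ D)
    (hC : ∀ f : H1, ‖f‖ ≤ C * ‖toForm M f‖) (g : FormSpace M) (a : H1) :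
    ‖(toForm M).symm g - a‖ ≤ D * ‖g - toForm M a‖ := by
  have h2 := hC ((toForm M).symm g - a)
  have h1 : toForm M ((toForm M).symm g - a) = g - toForm M a := by
    rw [map_sub, LinearEquiv.apply_symm_apply]
  rw [h1] at h2
  exact h2.trans (mul_le_mul_of_nonneg_right hle (norm_nonneg _))

theorem exists_norm_formEquiv_symm_sub_le (M : Medium) :
    ∃ C : ℝ, 0 < C ∧ ∀ (g : FormSpace M) (a : H1),
      ‖(formEquiv M).symm g - a‖ ≤ C * ‖g - formEquiv M a‖ := by
  obtain ⟨C, hC⟩ := exists_le_norm_toForm M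
  have hle : C ≤ |C| + 1 := by linarith [le_abs_self C]
  refine ⟨|C| + 1, by positivity, fun g a => ?_⟩
  exact norm_toForm_symm_sub_le hle hC g a

theorem exists_wave_near (M : Medium) (a : H1) (b : L2) {δ : ℝ} (hδ : 0 < δ) :
    ∃ U, IsWave M U ∧ ‖U 0 - (a, b)‖ < δ := by
  obtain ⟨C, hC0, hC⟩ := exists_norm_formEquiv_symm_sub_le M
  obtain ⟨u, v, huv, hu, hv⟩ := exists_abstractWave_near (formDisplacement_injective M)
    (denseRange_formDisplacement M) (formEquiv M a) b
    (δ := min (δ / C) δ) (lt_min (by positivity) hδ)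
  have h1 : ‖(formEquiv M).symm (u 0) - a‖ < δ := by
    refine (hC (u 0) a).trans_lt ?_
    rw [← lt_div_iff₀' hC0]
    exact hu.trans_le (min_le_left _ _)
  exact ⟨_, huv.isWave, max_lt h1 (hv.trans_le (min_le_right _ _))⟩

/-- The elastic form as a continuous functional of its second argument. -/
def elasticFunctional (M : Medium) (w : H1) : H1 →L[ℂ] ℂ :=
  (innerSL ℂ (formEquiv M w)).comp (formEquiv M : H1 →L[ℂ] FormSpace M) -
    (innerSL ℂ w.1.1).comp displacement

theorem elasticFunctional_apply (M : Medium) (w f : H1) :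
    elasticFunctional M w f = elasticForm M w f := by
  change inner ℂ (toForm M w) (toForm M f) - inner ℂ w.1.1 f.1.1 = _
  rw [inner_toForm, add_sub_cancel_right]

/-! ### Limits of waves -/

theorem tendsto_of_tendstoLocallyUniformly {X : Type*} [UniformSpace X] {U : ℕ → ℝ → X} {L : ℝ → X}
    (h : TendstoLocallyUniformly U L atTop) (t : ℝ) : Tendsto (fun n => U n t) atTop (𝓝 (L t)) :=
  (tendstoLocallyUniformlyOn_univ.2 h).tendsto_at (Set.mem_univ t)

theorem IsWave.of_tendstoLocallyUniformly {M : Medium} {U : ℕ → ℝ → H1 × L2} {L : ℝ → H1 × L2}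
    (hU : ∀ n, IsWave M (U n)) (hL : TendstoLocallyUniformly U L atTop) : IsWave M L := by
  have hpt : ∀ t, Tendsto (fun n => U n t) atTop (𝓝 (L t)) := fun t => tendsto_of_tendstoLocallyUniformly hL t
  have hfst : TendstoLocallyUniformly (fun n t => (U n t).1) (fun t => (L t).1) atTop :=
    uniformContinuous_fst.comp_tendstoLocallyUniformly hL
  have hsnd : TendstoLocallyUniformly (fun n t => (U n t).2) (fun t => (L t).2) atTop :=
    uniformContinuous_snd.comp_tendstoLocallyUniformly hL
  have hpt1 : ∀ t, Tendsto (fun n => (U n t).1) atTop (𝓝 (L t).1) := fun t => tendsto_of_tendstoLocallyUniformly hfst t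
  have hpt2 : ∀ t, Tendsto (fun n => (U n t).2) atTop (𝓝 (L t).2) := fun t => tendsto_of_tendstoLocallyUniformly hsnd t
  refine ⟨hL.continuous (Frequently.of_forall fun n => (hU n).continuous), fun t => ?_,
    fun w t => ?_⟩
  · exact hasDerivAt_of_tendstoLocallyUniformlyOn (f := fun n s => (U n s).1.1.1)
      (g := fun s => (L s).1.1.1) isOpen_univ
      (tendstoLocallyUniformlyOn_univ.2 hsnd)
      (Eventually.of_forall fun n s _ => (hU n).velocity s)
      (fun s _ => (displacement.continuous.tendsto _).comp (hpt1 s)) (Set.mem_univ t)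
  · have h1 : TendstoLocallyUniformly (fun n t => -elasticFunctional M w (U n t).1)
        (fun t => -elasticFunctional M w (L t).1) atTop :=
      (-elasticFunctional M w).uniformContinuous.comp_tendstoLocallyUniformly hfst
    simp only [elasticFunctional_apply] at h1
    exact hasDerivAt_of_tendstoLocallyUniformlyOn isOpen_univ
      (tendstoLocallyUniformlyOn_univ.2 h1)
      (f := fun n s => inner ℂ w.1.1 (U n s).2) (g := fun s => inner ℂ w.1.1 (L s).2)
      (Eventually.of_forall fun n s _ => (hU n).equation w s)
      (fun s _ => ((innerSL ℂ w.1.1).continuous.tendsto _).comp (hpt2 s)) (Set.mem_univ t)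

theorem exists_tendstoLocallyUniformly {X : Type*} [NormedAddCommGroup X] [CompleteSpace X]
    {U : ℕ → ℝ → X} {h : X} {C : ℝ} (hC : 0 ≤ C)
    (hlim0 : Tendsto (fun n => U n 0) atTop (𝓝 h))
    (hdiff : ∀ t n m, ‖U n t - U m t‖ ≤ C * (1 + |t|) * ‖U n 0 - U m 0‖) :
    ∃ L, TendstoLocallyUniformly U L atTop := by
  have hcauchy : ∀ t, CauchySeq fun n => U n t := by
    intro t
    have h0 := hlim0.cauchySeq
    rw [Metric.cauchySeq_iff'] at h0 ⊢
    intro ε hε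
    obtain ⟨N, hN⟩ := h0 (ε / (C * (1 + |t|) + 1)) (by positivity)
    refine ⟨N, fun n hn => ?_⟩
    have h1 := hN n hn
    rw [dist_eq_norm, lt_div_iff₀ (by positivity)] at h1
    rw [dist_eq_norm]
    have h2 := hdiff t n N
    have h3 := norm_nonneg (U n 0 - U N 0)
    linarith
  choose L hL using fun t => cauchySeq_tendsto_of_complete (hcauchy t)
  have hLdiff : ∀ t n, ‖L t - U n t‖ ≤ C * (1 + |t|) * ‖h - U n 0‖ := by
    intro t n
    have h1 : Tendsto (fun m => ‖U m t - U n t‖) atTop (𝓝 ‖L t - U n t‖) :=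
      ((hL t).sub_const _).norm
    have h2 : Tendsto (fun m => C * (1 + |t|) * ‖U m 0 - U n 0‖) atTop
        (𝓝 (C * (1 + |t|) * ‖h - U n 0‖)) :=
      ((hlim0.sub_const _).norm).const_mul _
    exact le_of_tendsto_of_tendsto' h1 h2 fun m => hdiff t m n
  have hloc : TendstoLocallyUniformly U L atTop := by
    rw [Metric.tendstoLocallyUniformly_iff]
    intro ε hε x
    refine ⟨Metric.ball x 1, Metric.ball_mem_nhds x one_pos, ?_⟩
    have h1 : Tendsto (fun n => C * (2 + |x|) * ‖h - U n 0‖) atTop (𝓝 0) := by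
      have h2 := ((hlim0.const_sub h).norm).const_mul (C * (2 + |x|))
      rw [sub_self, norm_zero, mul_zero] at h2
      exact h2
    filter_upwards [h1.eventually_lt_const hε] with n hn y hy
    rw [dist_eq_norm]
    refine (hLdiff y n).trans_lt (lt_of_le_of_lt ?_ hn)
    have h3 : |y| ≤ 1 + |x| := by
      have h4 : |y - x| < 1 := by simpa [Real.dist_eq] using hy
      have h5 := abs_sub_abs_le_abs_sub y x
      linarith
    have h6 := mul_le_mul_of_nonneg_left (by linarith : 1 + |y| ≤ 2 + |x|) hC
    exact mul_le_mul_of_nonneg_right h6 (norm_nonneg _)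
  exact ⟨L, hloc⟩

/-- Waves with data tending to `h` exist by spectral cutoff. Their differences are waves, so the a
priori bound makes them converge locally uniformly in time. -/
theorem exists_wave (M : Medium) (h : H1 × L2) : ∃ U : ℝ → H1 × L2, IsWave M U ∧ U 0 = h := by
  obtain ⟨C, hC, hbound⟩ := exists_wave_bound M
  choose U hU hU0 using fun n : ℕ =>
    exists_wave_near M h.1 h.2 (δ := 1 / ((n : ℝ) + 1)) (by positivity)
  have hlim0 : Tendsto (fun n => U n 0) atTop (𝓝 h) := by
    rw [tendsto_iff_norm_sub_tendsto_zero]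
    exact squeeze_zero (fun _ => norm_nonneg _) (fun n => (hU0 n).le)
      tendsto_one_div_add_atTop_nhds_zero_nat
  obtain ⟨L, hL⟩ := exists_tendstoLocallyUniformly hC hlim0 fun t n m =>
    hbound _ ((hU n).sub (hU m)) t
  exact ⟨L, IsWave.of_tendstoLocallyUniformly hU hL,
    tendsto_nhds_unique (tendsto_of_tendstoLocallyUniformly hL 0) hlim0⟩

/-! ### The wave group on the energy space -/

section WaveGroup

variable (M : Medium)

/-- A displacement and a velocity as Cauchy data. -/
def toData (p : H1 × L2) : CauchyData M := p

theorem exists_wave_toData (h : CauchyData M) :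
    ∃ U : ℝ → H1 × L2, IsWave M U ∧ toData M (U 0) = h := exists_wave M h

theorem exists_propagate_eq (t : ℝ) (h : CauchyData M) :
    ∃ U : ℝ → H1 × L2, IsWave M U ∧ toData M (U 0) = h ∧ propagate M t h = toData M (U t) := by
  have hU := exists_wave M h
  exact ⟨hU.choose, hU.choose_spec.1, hU.choose_spec.2, dif_pos hU⟩

variable {M} in
theorem IsWave.dist_toData {U W : ℝ → H1 × L2} (hU : IsWave M U) (hW : IsWave M W) (t : ℝ) :
    dist (toData M (U t)) (toData M (W t)) = dist (toData M (U 0)) (toData M (W 0)) := by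
  rw [dist_eq_norm, dist_eq_norm]
  exact hU.norm_sub_eq hW t

theorem dist_propagate (t : ℝ) (h k : CauchyData M) :
    dist (propagate M t h) (propagate M t k) = dist h k := by
  obtain ⟨U, hU, hU0, hUt⟩ := exists_propagate_eq M t h
  obtain ⟨W, hW, hW0, hWt⟩ := exists_propagate_eq M t k
  rw [hUt, hWt, hU.dist_toData hW, hU0, hW0]

theorem uniformContinuous_propagate (t : ℝ) : UniformContinuous (propagate M t) :=
  (Isometry.of_dist_eq (dist_propagate M t)).uniformContinuous

variable {M} in
-- `propagate` picks some wave with the given data. By conservation of energy for the difference,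
-- any other choice is at energy distance zero, so the two coincide in the completion.
theorem IsWave.propagator_coe {U : ℝ → H1 × L2} (hU : IsWave M U) (t : ℝ) :
    propagator M t (toData M (U 0) : EnergySpace M) = (toData M (U t) : EnergySpace M) := by
  rw [propagator, Completion.map_coe (uniformContinuous_propagate M t)]
  obtain ⟨W, hW, hW0, hWt⟩ := exists_propagate_eq M t (toData M (U 0))
  refine eq_of_dist_eq_zero ?_
  rw [Completion.dist_eq, hWt, hW.dist_toData hU, hW0, dist_self]

theorem continuous_propagator (t : ℝ) : Continuous (propagator M t) := Completion.continuous_map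

theorem toData_add (p q : H1 × L2) : toData M (p + q) = toData M p + toData M q := rfl

theorem toData_smul (c : ℂ) (p : H1 × L2) : toData M (c • p) = c • toData M p := rfl

theorem propagator_add (t : ℝ) (f g : EnergySpace M) :
    propagator M t (f + g) = propagator M t f + propagator M t g := by
  have hc := continuous_propagator M t
  refine Completion.induction_on₂ f g (isClosed_eq (by fun_prop) (by fun_prop)) fun a b => ?_
  obtain ⟨U, hU, rfl⟩ := exists_wave_toData M a
  obtain ⟨W, hW, rfl⟩ := exists_wave_toData M b
  rw [hU.propagator_coe t, hW.propagator_coe t, ← Completion.coe_add, ← Completion.coe_add,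
    ← toData_add, ← toData_add]
  exact (hU.add hW).propagator_coe t

theorem propagator_smul (t : ℝ) (c : ℂ) (f : EnergySpace M) :
    propagator M t (c • f) = c • propagator M t f := by
  have hc := continuous_propagator M t
  have hs : Continuous fun f : EnergySpace M => c • f := continuous_const_smul c
  refine Completion.induction_on f (isClosed_eq (hc.comp hs) (hs.comp hc)) fun a => ?_
  obtain ⟨U, hU, rfl⟩ := exists_wave_toData M a
  rw [hU.propagator_coe t, ← Completion.coe_smul, ← Completion.coe_smul, ← toData_smul,
    ← toData_smul]
  exact (hU.smul c).propagator_coe t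

theorem propagator_propagator (s t : ℝ) (f : EnergySpace M) :
    propagator M s (propagator M t f) = propagator M (t + s) f := by
  have h1 := continuous_propagator M t
  have h2 := continuous_propagator M s
  have h3 := continuous_propagator M (t + s)
  refine Completion.induction_on f (isClosed_eq (by fun_prop) (by fun_prop)) fun a => ?_
  obtain ⟨U, hU, hU0⟩ := exists_wave_toData M a
  have e1 := hU.propagator_coe t
  have e2 := hU.propagator_coe (t + s)
  have e3 := (hU.shift t).propagator_coe s
  rw [hU0] at e1 e2
  rw [add_zero] at e3
  rw [e1, e2, e3]

theorem propagator_zero (f : EnergySpace M) : propagator M 0 f = f := by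
  have h1 := continuous_propagator M 0
  refine Completion.induction_on f (isClosed_eq (by fun_prop) (by fun_prop)) fun a => ?_
  obtain ⟨U, hU, hU0⟩ := exists_wave_toData M a
  have e1 := hU.propagator_coe 0
  rwa [hU0] at e1

theorem norm_propagator (t : ℝ) (f : EnergySpace M) : ‖propagator M t f‖ = ‖f‖ := by
  have h1 := continuous_propagator M t
  refine Completion.induction_on f (isClosed_eq (by fun_prop) (by fun_prop)) fun a => ?_
  obtain ⟨U, hU, hU0⟩ := exists_wave_toData M a
  have e1 := hU.propagator_coe t
  rw [hU0] at e1
  rw [e1, Completion.norm_coe, Completion.norm_coe, ← hU0]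
  exact hU.norm_eq t

/-- The propagator as a unitary operator. -/
def waveGroup (t : ℝ) : EnergySpace M ≃ₗᵢ[ℂ] EnergySpace M where
  toFun := propagator M t
  invFun := propagator M (-t)
  map_add' := propagator_add M t
  map_smul' := propagator_smul M t
  left_inv f := by rw [propagator_propagator, add_neg_cancel, propagator_zero]
  right_inv f := by rw [propagator_propagator, neg_add_cancel, propagator_zero]
  norm_map' := norm_propagator M t

/-! ### Time reversal -/

/-- Time reversal of Cauchy data as a linear isometry. -/
def reverseDataₗᵢ : CauchyData M →ₗᵢ[ℂ] CauchyData M where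
  toFun := reverseData M
  map_add' a b := Prod.ext rfl (neg_add _ _)
  map_smul' c a := Prod.ext rfl (smul_neg _ _).symm
  norm_map' a := by
    refine (sq_eq_sq₀ (norm_nonneg _) (norm_nonneg _)).1 ?_
    rw [cauchyData_norm_sq, cauchyData_norm_sq]
    have h : ‖(reverseData M a).2‖ = ‖a.2‖ := norm_neg a.2
    exact congrArg (fun r => r ^ 2 + (elasticForm M a.1 a.1).re) h

theorem timeReversal_coe (a : CauchyData M) :
    timeReversal M (a : EnergySpace M) = (reverseData M a : EnergySpace M) :=
  Completion.map_coe (reverseDataₗᵢ M).isometry.uniformContinuous a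

theorem continuous_timeReversal : Continuous (timeReversal M) := Completion.continuous_map

theorem timeReversal_timeReversal (f : EnergySpace M) :
    timeReversal M (timeReversal M f) = f := by
  have h1 := continuous_timeReversal M
  refine Completion.induction_on f (isClosed_eq (by fun_prop) (by fun_prop)) fun a => ?_
  rw [timeReversal_coe, timeReversal_coe]
  exact congrArg _ (Prod.ext rfl (neg_neg a.2))

/-- Time reversal as a unitary operator. -/
def reversal : EnergySpace M ≃ₗᵢ[ℂ] EnergySpace M where
  toFun := timeReversal M
  invFun := timeReversal M
  map_add' f g := by
    have h1 := continuous_timeReversal M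
    refine Completion.induction_on₂ f g (isClosed_eq (by fun_prop) (by fun_prop)) fun a b => ?_
    rw [← Completion.coe_add, timeReversal_coe, timeReversal_coe, timeReversal_coe,
      ← Completion.coe_add]
    exact congrArg _ ((reverseDataₗᵢ M).map_add a b)
  map_smul' c f := by
    have h1 := continuous_timeReversal M
    have hs : Continuous fun f : EnergySpace M => c • f := continuous_const_smul c
    refine Completion.induction_on f (isClosed_eq (h1.comp hs) (hs.comp h1)) fun a => ?_
    rw [RingHom.id_apply, ← Completion.coe_smul, timeReversal_coe, timeReversal_coe,
      ← Completion.coe_smul]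
    exact congrArg _ ((reverseDataₗᵢ M).map_smul c a)
  left_inv := timeReversal_timeReversal M
  right_inv := timeReversal_timeReversal M
  norm_map' f := by
    have h1 := continuous_timeReversal M
    refine Completion.induction_on f (isClosed_eq h1.norm continuous_norm) fun a => ?_
    change ‖timeReversal M (a : EnergySpace M)‖ = _
    rw [timeReversal_coe, Completion.norm_coe, Completion.norm_coe]
    exact (reverseDataₗᵢ M).norm_map a

theorem timeReversal_propagator (t : ℝ) (f : EnergySpace M) :
    timeReversal M (propagator M t f) = propagator M (-t) (timeReversal M f) := by
  have h1 := continuous_timeReversal M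
  have h2 := continuous_propagator M t
  have h3 := continuous_propagator M (-t)
  refine Completion.induction_on f (isClosed_eq (by fun_prop) (by fun_prop)) fun a => ?_
  obtain ⟨U, hU, hU0⟩ := exists_wave_toData M a
  have e1 := hU.propagator_coe t
  have e2 := hU.reverse.propagator_coe (-t)
  rw [neg_neg, neg_zero] at e2
  rw [hU0] at e1
  rw [e1, timeReversal_coe, timeReversal_coe, ← hU0]
  exact e2.symm

end WaveGroup

/-! ### Data supported in open sets -/

section Support

theorem H10_mono {U V : Set R3} (h : U ⊆ V) : H10 U ≤ H10 V :=
  Submodule.topologicalClosure_mono <| Submodule.span_mono fun _ ⟨φ, h1, h2, h3, h4⟩ =>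
    ⟨φ, h1, h2, h3.trans h, h4⟩

theorem L2on_mono {U V : Set R3} (h : U ⊆ V) : L2on U ≤ L2on V := fun f hf => by
  have hf' : ∀ᵐ x ∂(volume : Measure R3), x ∉ U → f x = 0 := hf
  change ∀ᵐ x ∂(volume : Measure R3), x ∉ V → f x = 0
  filter_upwards [hf'] with x hx hV
  exact hx fun hU => hV (h hU)

theorem dataOn_mono (M : Medium) {U V : Set R3} (h : U ⊆ V) : dataOn M U ≤ dataOn M V :=
  Submodule.topologicalClosure_mono <| Submodule.map_mono <|
    Submodule.prod_mono (H10_mono h) (L2on_mono h)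

theorem timeReversal_mem_dataOn (M : Medium) {U : Set R3} {f : EnergySpace M}
    (hf : f ∈ dataOn M U) : timeReversal M f ∈ dataOn M U := by
  refine map_mem_closure (continuous_timeReversal M) hf ?_
  rintro _ ⟨a, ha, rfl⟩
  refine ⟨reverseData M a, ⟨ha.1, (L2on U).neg_mem ha.2⟩, ?_⟩
  exact (timeReversal_coe M a).symm

theorem grad_ae_eq_zero_of_contDiff {U : Set R3} {f : H1} {φ : R3 → C3} (hφ : ContDiff ℝ ∞ φ)
    (hc : HasCompactSupport φ) (hs : tsupport φ ⊆ U) (hf : f.1.1 =ᵐ[volume] φ) (j : Fin 3) :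
    ∀ᵐ x ∂(volume : Measure R3), x ∉ U → f.1.2 j x = 0 := by
  obtain ⟨g, hg, hg'⟩ := exists_H1_of_contDiff hφ hc
  obtain rfl : f = g := H1_ext (Lp.ext (hf.trans hg.symm))
  filter_upwards [hg' j] with x hx hxU
  have h0 : fderiv ℝ φ x = 0 :=
    image_eq_zero_of_notMem_tsupport fun hx' => hxU (hs (tsupport_fderiv_subset ℝ hx'))
  rw [hx, h0, zero_apply]

theorem elasticForm_eq_zero_of_disjoint_grad (M : Medium) {U V : Set R3} (hUV : Disjoint U V)
    {f g : H1} (hf : ∀ j, ∀ᵐ x ∂(volume : Measure R3), x ∉ U → f.1.2 j x = 0)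
    (hg : ∀ j, ∀ᵐ x ∂(volume : Measure R3), x ∉ V → g.1.2 j x = 0) : elasticForm M f g = 0 := by
  rw [elasticForm]
  refine integral_eq_zero_of_ae ?_
  filter_upwards [ae_all_iff.2 hf, ae_all_iff.2 hg] with x h1 h2
  by_cases hx : x ∈ U
  · have hxV := Set.disjoint_left.1 hUV hx
    simp [elasticDensity, divergence, strain, h2 _ hxV]
  · simp [elasticDensity, divergence, strain, h1 _ hx]

theorem H10_le_of_isClosed {U : Set R3} {K : Submodule ℂ H1} (hK : IsClosed (K : Set H1))
    (h : ∀ (f : H1) (φ : R3 → C3), ContDiff ℝ ∞ φ → HasCompactSupport φ → tsupport φ ⊆ U →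
      f.1.1 =ᵐ[volume] φ → f ∈ K) : H10 U ≤ K :=
  Submodule.topologicalClosure_minimal _ (Submodule.span_le.2 fun f ⟨φ, h1, h2, h3, h4⟩ =>
    h f φ h1 h2 h3 h4) hK

/-- For smooth fields the gradients have disjoint supports. The general case follows by continuity
of the form in each argument separately. -/
theorem elasticForm_eq_zero_of_disjoint (M : Medium) {U V : Set R3} (hUV : Disjoint U V)
    {f g : H1} (hf : f ∈ H10 U) (hg : g ∈ H10 V) : elasticForm M f g = 0 := by
  have h1 : ∀ (f : H1) (φ : R3 → C3), ContDiff ℝ ∞ φ → HasCompactSupport φ → tsupport φ ⊆ U →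
      f.1.1 =ᵐ[volume] φ → elasticForm M f g = 0 := by
    intro f φ hφ hc hs hfφ
    have h2 : H10 V ≤ (elasticFunctional M f).ker := by
      refine H10_le_of_isClosed (elasticFunctional M f).isClosed_ker
        fun k ψ hψ hc' hs' hkψ => ?_
      rw [LinearMap.mem_ker]
      exact (elasticFunctional_apply M f k).trans
        (elasticForm_eq_zero_of_disjoint_grad M hUV
          (grad_ae_eq_zero_of_contDiff hφ hc hs hfφ) (grad_ae_eq_zero_of_contDiff hψ hc' hs' hkψ))
    exact (elasticFunctional_apply M f g).symm.trans (h2 hg)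
  have h3 : H10 U ≤ (elasticFunctional M g).ker := by
    refine H10_le_of_isClosed (elasticFunctional M g).isClosed_ker
      fun k ψ hψ hc' hs' hkψ => ?_
    rw [LinearMap.mem_ker]
    refine (elasticFunctional_apply M g k).trans ?_
    rw [← elasticForm_conj, h1 k ψ hψ hc' hs' hkψ, star_zero]
  have h4 : elasticForm M g f = 0 := (elasticFunctional_apply M g f).symm.trans (h3 hf)
  rw [← elasticForm_conj, h4, star_zero]

theorem inner_eq_zero_of_disjoint {U V : Set R3} (hUV : Disjoint U V) {f g : L2}
    (hf : f ∈ L2on U) (hg : g ∈ L2on V) : inner ℂ f g = 0 := by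
  have hf' : ∀ᵐ x ∂(volume : Measure R3), x ∉ U → f x = 0 := hf
  have hg' : ∀ᵐ x ∂(volume : Measure R3), x ∉ V → g x = 0 := hg
  rw [MeasureTheory.L2.inner_def]
  refine integral_eq_zero_of_ae ?_
  filter_upwards [hf', hg'] with x h1 h2
  by_cases hx : x ∈ U
  · rw [h2 (Set.disjoint_left.1 hUV hx), inner_zero_right, Pi.zero_apply]
  · rw [h1 hx, inner_zero_left, Pi.zero_apply]

theorem dataOn_le_orthogonal (M : Medium) {U V : Set R3} (hUV : Disjoint U V) :
    dataOn M U ≤ (dataOn M V)ᗮ := by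
  unfold dataOn
  rw [Submodule.orthogonal_closure]
  refine Submodule.topologicalClosure_minimal _ ?_ (Submodule.isClosed_orthogonal _)
  rintro _ ⟨a, ha, rfl⟩
  refine (Submodule.mem_orthogonal _ _).2 ?_
  rintro _ ⟨b, hb, rfl⟩
  refine (Completion.inner_coe (𝕜 := ℂ) (E := CauchyData M) b a).trans ?_
  exact (congrArg₂ (· + ·) (inner_eq_zero_of_disjoint hUV.symm hb.2 ha.2)
    (elasticForm_eq_zero_of_disjoint M hUV.symm hb.1 ha.1)).trans (add_zero _)

end Support

/-! ### Scattering control -/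

theorem mem_orthogonal_span {E : Type*} [NormedAddCommGroup E] [InnerProductSpace ℂ E] {s : Set E}
    {w : E} (h : ∀ u ∈ s, inner ℂ u w = 0) : w ∈ (Submodule.span ℂ s)ᗮ := by
  refine (Submodule.mem_orthogonal _ _).2 fun u hu => ?_
  induction hu using Submodule.span_induction with
  | mem u hu => exact h u hu
  | zero => exact inner_zero_left _
  | add u v _ _ hu hv => rw [inner_add_left, hu, hv, add_zero]
  | smul c u _ hu => rw [inner_smul_left, hu, mul_zero]

namespace Setup

variable (S : Setup)

theorem Rt_sub (t : ℝ) (f g : S.E) : S.Rt t (f - g) = S.Rt t f - S.Rt t g :=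
  (waveGroup S.medium t).map_sub f g

theorem Rt_Rt (s t : ℝ) (f : S.E) : S.Rt s (S.Rt t f) = S.Rt (t + s) f :=
  propagator_propagator S.medium s t f

theorem Rt_zero (f : S.E) : S.Rt 0 f = f := propagator_zero S.medium f

theorem inner_Rt_left (t : ℝ) (f g : S.E) : inner ℂ (S.Rt t f) g = inner ℂ f (S.Rt (-t) g) := by
  have h := (waveGroup S.medium t).inner_map_map f (S.Rt (-t) g)
  have h2 : waveGroup S.medium t (S.Rt (-t) g) = g := by
    change S.Rt t (S.Rt (-t) g) = g
    rw [Rt_Rt, neg_add_cancel, Rt_zero]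
  rw [h2] at h
  exact h

theorem ν_ν (f : S.E) : S.ν (S.ν f) = f := timeReversal_timeReversal S.medium f

theorem ν_sub (f g : S.E) : S.ν (f - g) = S.ν f - S.ν g := (reversal S.medium).map_sub f g

theorem ν_Rt (t : ℝ) (f : S.E) : S.ν (S.Rt t f) = S.Rt (-t) (S.ν f) :=
  timeReversal_propagator S.medium t f

theorem inner_ν_left (f g : S.E) : inner ℂ (S.ν f) g = inner ℂ f (S.ν g) := by
  have h := (reversal S.medium).inner_map_map f (S.ν g)
  have h2 : reversal S.medium (S.ν g) = g := S.ν_ν g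
  rw [h2] at h
  exact h

/-- The adjoint of `R` is `R_{-2T} ν`, which equals `ν R_{2T}`. -/
theorem inner_R_left (f g : S.E) : inner ℂ (S.R f) g = inner ℂ f (S.R g) := by
  rw [R, inner_ν_left, inner_Rt_left, R, ν_Rt]

theorem isClosed_HstarTilde : IsClosed (S.HstarTilde : Set S.E) :=
  Submodule.isClosed_topologicalClosure _

theorem ν_mem_HstarTilde {f : S.E} (hf : f ∈ S.HstarTilde) : S.ν f ∈ S.HstarTilde :=
  timeReversal_mem_dataOn S.medium hf

theorem piStar_mem (f : S.E) : S.piStar f ∈ S.HstarTilde := Submodule.starProjection_apply_mem _ _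

theorem piStar_eq_self {f : S.E} (hf : f ∈ S.HstarTilde) : S.piStar f = f :=
  Submodule.starProjection_eq_self_iff.2 hf

theorem piStar_eq_zero_iff {f : S.E} : S.piStar f = 0 ↔ f ∈ S.HstarTildeᗮ :=
  Submodule.starProjection_apply_eq_zero_iff _

theorem piBar_apply (f : S.E) : S.piBar f = f - S.piStar f := rfl

theorem piBar_mem (f : S.E) : S.piBar f ∈ S.HstarTildeᗮ :=
  Submodule.sub_starProjection_mem_orthogonal f

theorem piStar_ν (f : S.E) : S.piStar (S.ν f) = S.ν (S.piStar f) := by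
  refine Submodule.eq_starProjection_of_mem_orthogonal (S.ν_mem_HstarTilde (S.piStar_mem f)) ?_
  rw [← ν_sub]
  refine (Submodule.mem_orthogonal _ _).2 fun k hk => ?_
  rw [← inner_ν_left]
  exact (Submodule.mem_orthogonal _ _).1 (S.piBar_mem f) _ (S.ν_mem_HstarTilde hk)

theorem piStar_of_mem_H {f : S.E} (hf : f ∈ S.H) : S.piStar f = 0 := by
  refine S.piStar_eq_zero_iff.2 (dataOn_le_orthogonal S.medium ?_ hf)
  exact Set.disjoint_left.2 fun x hx hx' => hx'.2 (subset_closure hx)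

theorem HstarTilde_le_CTilde : S.HstarTilde ≤ S.CTilde :=
  dataOn_mono S.medium Set.sdiff_subset

theorem Hstar_le_C : S.Hstar ≤ S.C := inf_le_inf_right _ S.HstarTilde_le_CTilde

theorem piStar_R_mem_Hstar {h : S.E} (hh : h ∈ S.C) : S.piStar (S.R h) ∈ S.Hstar := by
  have h1 : S.R h ∈ S.Gᗮ := by
    refine mem_orthogonal_span fun g hg => ?_
    rw [← inner_R_left]
    -- `R` preserves the set spanning `G`: the data of `R g` are `ν R_{2T} g`, and `R_{2T} R g = ν
    -- g`.
    refine (Submodule.mem_orthogonal _ _).1 hh.2 _ (Submodule.subset_span ⟨?_, ?_⟩)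
    · exact S.ν_mem_HstarTilde hg.2
    · rw [R, ν_Rt, Rt_Rt, neg_add_cancel, Rt_zero]
      exact S.ν_mem_HstarTilde hg.1
  refine ⟨S.piStar_mem _, ?_⟩
  have h2 := S.Gᗮ.sub_mem h1 (Submodule.orthogonal_le S.G_le (S.piBar_mem (S.R h)))
  rwa [piBar_apply, sub_sub_cancel] at h2

/-! ### The outgoing wave and the control equation -/

/-- The wave field at time `T` of the part of the wave that is outside the control region at
time `2T`. -/
def outgoing (h : S.E) : S.E := S.Rt (-S.T) (S.piBar (S.Rt (2 * S.T) h))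

theorem Rt_outgoing (h : S.E) : S.Rt S.T (S.outgoing h) = S.piBar (S.Rt (2 * S.T) h) := by
  rw [outgoing, Rt_Rt, neg_add_cancel, Rt_zero]

theorem Rt_neg_outgoing (h : S.E) :
    S.Rt (-S.T) (S.outgoing h) = S.Rt (-(2 * S.T)) (S.piBar (S.Rt (2 * S.T) h)) := by
  rw [outgoing, Rt_Rt]
  congr 1
  ring

/-- Since `ν` commutes with `π⋆` and reverses time, `R π⋆ R = R_{-2T} π⋆ R_{2T}`; then `π⋆ = 1 - π̄`
brings in the outgoing wave. -/
theorem scatteringControl_iff (h₀ h : S.E) :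
    S.ScatteringControl h₀ h ↔
      h - S.piStar h + S.piStar (S.Rt (-S.T) (S.outgoing h)) = h₀ := by
  have h1 : S.R (S.piStar (S.R h)) = h - S.Rt (-S.T) (S.outgoing h) := by
    rw [Rt_neg_outgoing, piBar_apply, Rt_sub, Rt_Rt, add_neg_cancel, Rt_zero, sub_sub_cancel, R, R,
      piStar_ν, ν_Rt, ν_ν]
  rw [ScatteringControl, h1, map_sub, sub_sub_eq_add_sub, add_sub_right_comm]

/-- Both `h - π⋆ h` and `h₀` are killed by `π⋆`, so applying `π⋆` separates the equation into its
two components. -/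
theorem scatteringControl_iff_and {h₀ h : S.E} (hh₀ : h₀ ∈ S.H) :
    S.ScatteringControl h₀ h ↔
      h - S.piStar h = h₀ ∧ S.piStar (S.Rt (-S.T) (S.outgoing h)) = 0 := by
  rw [scatteringControl_iff]
  constructor
  · intro hs
    have h1 := congrArg S.piStar hs
    rw [map_add, map_sub, S.piStar_eq_self (S.piStar_mem h), sub_self, zero_add,
      S.piStar_eq_self (S.piStar_mem _), S.piStar_of_mem_H hh₀] at h1
    rw [h1, add_zero] at hs
    exact ⟨hs, h1⟩
  · rintro ⟨h1, h2⟩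
    rw [h1, h2, add_zero]

theorem outgoing_mem_imBackward (h : S.E) : S.outgoing h ∈ S.imBackwardᗮ := by
  refine mem_orthogonal_span ?_
  rintro _ ⟨k, -, rfl⟩
  change inner ℂ (S.Rt (-S.T) (S.piStar k)) _ = 0
  rw [inner_Rt_left, neg_neg, Rt_outgoing]
  exact (Submodule.mem_orthogonal _ _).1 (S.piBar_mem _) _ (S.piStar_mem k)

theorem outgoing_mem_imReversed (h : S.E) : S.outgoing h ∈ S.imReversedᗮ := by
  refine mem_orthogonal_span ?_
  rintro _ ⟨k, -, rfl⟩
  change inner ℂ (S.ν (S.Rt S.T (S.piStar k))) _ = 0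
  rw [ν_Rt, inner_Rt_left, neg_neg, Rt_outgoing]
  exact (Submodule.mem_orthogonal _ _).1 (S.piBar_mem _) _ (S.ν_mem_HstarTilde (S.piStar_mem k))

theorem outgoing_mem_imForward {h : S.E} (hh : S.piStar (S.Rt (-S.T) (S.outgoing h)) = 0) :
    S.outgoing h ∈ S.imForwardᗮ := by
  refine mem_orthogonal_span ?_
  rintro _ ⟨k, -, rfl⟩
  change inner ℂ (S.Rt S.T (S.piStar k)) _ = 0
  rw [inner_Rt_left]
  exact (Submodule.mem_orthogonal _ _).1 (S.piStar_eq_zero_iff.1 hh) _ (S.piStar_mem k)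

theorem Rt_mem_imForward {k : S.E} (hk : k ∈ S.Hstar) : S.Rt S.T k ∈ S.imForward :=
  Submodule.subset_span ⟨k, S.Hstar_le_C hk, by
    change S.Rt S.T (S.piStar k) = _
    rw [S.piStar_eq_self hk.1]⟩

theorem ν_Rt_mem_imReversed {k : S.E} (hk : k ∈ S.Hstar) : S.ν (S.Rt S.T k) ∈ S.imReversed :=
  Submodule.subset_span ⟨k, S.Hstar_le_C hk, by
    change S.ν (S.Rt S.T (S.piStar k)) = _
    rw [S.piStar_eq_self hk.1]⟩

theorem controllable_orthogonal : S.controllableᗮ = (S.imForward ⊔ S.imReversed)ᗮ :=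
  Submodule.orthogonal_closure _

/-- The wave generated by `h` at time `T`, minus the part outgoing at time `2T`. -/
theorem Rt_sub_outgoing (h : S.E) :
    S.Rt S.T h - S.outgoing h = S.ν (S.Rt S.T (S.piStar (S.R h))) := by
  rw [outgoing, piBar_apply, Rt_sub, Rt_Rt, R, piStar_ν, ν_Rt, ν_ν]
  rw [show 2 * S.T + -S.T = S.T by ring, sub_sub_cancel]

theorem outgoing_eq_starProjection {h₀ h : S.E} (hh : h ∈ S.C) (h1 : h - S.piStar h = h₀)
    (h2 : S.outgoing h ∈ (S.imForward ⊔ S.imReversed)ᗮ) :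
    S.outgoing h = S.controllableᗮ.starProjection (S.Rt S.T h₀) := by
  refine (Submodule.eq_starProjection_of_mem_orthogonal ?_ ?_).symm
  · rwa [controllable_orthogonal]
  · refine Submodule.le_orthogonal_orthogonal _ (Submodule.le_topologicalClosure _ ?_)
    -- With `h₀ = h - π⋆ h`, the difference `R_T h₀ - w` is `ν R_T π⋆ R h - R_T π⋆ h`, a sum of
    -- elements of the two images.
    rw [← h1, Rt_sub, sub_right_comm, Rt_sub_outgoing]
    refine Submodule.sub_mem _ (Submodule.mem_sup_right ?_) (Submodule.mem_sup_left ?_)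
    · exact S.ν_Rt_mem_imReversed (S.piStar_R_mem_Hstar hh)
    · exact S.Rt_mem_imForward (S.piStar_mem_Hstar hh)

theorem Rt_neg_outgoing_mem_orthogonal_G (h : S.E) :
    S.Rt (-S.T) (S.outgoing h) ∈ S.Gᗮ := by
  refine mem_orthogonal_span fun g hg => ?_
  rw [Rt_neg_outgoing, ← inner_Rt_left]
  exact (Submodule.mem_orthogonal _ _).1 (S.piBar_mem _) _ hg.2

/-- A vector of `HstarTilde` splits into a part in the closure of `G` and a part in `Hstar`. The
hypothesis handles the second; `R_{-T} w` is orthogonal to the first for every `h`. -/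
theorem piStar_Rt_neg_outgoing {h : S.E} (hh : S.outgoing h ∈ S.imForwardᗮ) :
    S.piStar (S.Rt (-S.T) (S.outgoing h)) = 0 := by
  rw [piStar_eq_zero_iff]
  refine (Submodule.mem_orthogonal _ _).2 fun k hk => ?_
  -- `G` is defined as a span, so its closure, which has the same orthogonal complement, is used for
  -- the projection.
  have : CompleteSpace S.G.topologicalClosure :=
    S.G.isClosed_topologicalClosure.completeSpace_coe
  set p := S.G.topologicalClosure.starProjection k with hp
  have hpm : p ∈ S.G.topologicalClosure := Submodule.starProjection_apply_mem _ _
  have h1 : k - p ∈ S.Hstar := by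
    refine ⟨S.HstarTilde.sub_mem hk ?_, ?_⟩
    · exact Submodule.topologicalClosure_minimal _ S.G_le S.isClosed_HstarTilde hpm
    · rw [SetLike.mem_coe, ← Submodule.orthogonal_closure]
      exact Submodule.sub_starProjection_mem_orthogonal k
  have h2 : inner ℂ (k - p) (S.Rt (-S.T) (S.outgoing h)) = 0 := by
    rw [← inner_Rt_left]
    exact (Submodule.mem_orthogonal _ _).1 hh _ (S.Rt_mem_imForward h1)
  have h3 : inner ℂ p (S.Rt (-S.T) (S.outgoing h)) = 0 := by
    have h4 := S.Rt_neg_outgoing_mem_orthogonal_G h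
    rw [← Submodule.orthogonal_closure] at h4
    exact (Submodule.mem_orthogonal _ _).1 h4 _ hpm
  rw [← sub_add_cancel k p, inner_add_left, h2, h3, add_zero]

end Setup

end ElasticScattering

end

open ElasticScattering
theorem mainTheorem7 (S : Setup) (h₀ h : S.E) (hh₀ : h₀ ∈ S.H) (hh : h ∈ S.C) :
    (S.ScatteringControl h₀ h →
      S.Rt (-S.T) (S.piBar (S.Rt (2 * S.T) h)) ∈ (S.imForward ⊔ S.imReversed)ᗮ ∧
      S.Rt (-S.T) (S.piBar (S.Rt (2 * S.T) h)) ∈ (S.imForward ⊔ S.imBackward)ᗮ ∧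
      S.Rt (-S.T) (S.piBar (S.Rt (2 * S.T) h)) =
        S.controllableᗮ.starProjection (S.Rt S.T h₀)) ∧
    (h - h₀ ∈ S.Hstar →
      S.Rt (-S.T) (S.piBar (S.Rt (2 * S.T) h)) =
        S.controllableᗮ.starProjection (S.Rt S.T h₀) →
      S.ScatteringControl h₀ h) := by
  constructor
  · intro hs
    obtain ⟨h1, h2⟩ := (S.scatteringControl_iff_and hh₀).1 hs
    have hF := S.outgoing_mem_imForward h2
    have hFR : S.outgoing h ∈ (S.imForward ⊔ S.imReversed)ᗮ := by
      rw [← Submodule.inf_orthogonal]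
      exact ⟨hF, S.outgoing_mem_imReversed h⟩
    have hFB : S.outgoing h ∈ (S.imForward ⊔ S.imBackward)ᗮ := by
      rw [← Submodule.inf_orthogonal]
      exact ⟨hF, S.outgoing_mem_imBackward h⟩
    exact ⟨hFR, hFB, S.outgoing_eq_starProjection hh h1 hFR⟩
  · intro hk hw
    rw [S.scatteringControl_iff_and hh₀]
    -- The form `h = h₀ + k` supplies the component of the control equation outside the range of
    -- `π⋆`; what remains is `π⋆ R_{-T} w = 0`.
    have h1 : S.piStar h = h - h₀ := by
      have h2 := S.piStar_eq_self hk.1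
      rwa [map_sub, S.piStar_of_mem_H hh₀, sub_zero] at h2
    have h3 : S.outgoing h ∈ S.controllableᗮ := by
      have h4 : S.outgoing h = S.controllableᗮ.starProjection (S.Rt S.T h₀) := hw
      rw [h4]
      exact Submodule.starProjection_apply_mem _ _
    rw [S.controllable_orthogonal] at h3
    refine ⟨by rw [h1, sub_sub_cancel], S.piStar_Rt_neg_outgoing ?_⟩
    exact Submodule.orthogonal_le le_sup_left h3
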